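/- For integers $\ell\ge 1$ and $0\le k\le n$, let $A(\ell,n,k)$ be the number of ordered $\ell$-tuples $(\sigma_1,\ldots,\sigma_\ell)$ of pairwise commuting permutations in the symmetric group $\mathfrak{S}_n$ such that the subgroup generated by $\sigma_1,\ldots,\sigma_\ell$ has exactly $k$ orbits on $\{1,\ldots,n\}$. Put $\mathcal{K}_\ell:=(\ell-1)!\,\zeta(2)\zeta(3)\cdots\zeta(\ell)$ and, for $\ell\ge 2$ and $1\le k\le n$, \[ \mathscr{S}_\ell(n,k):=-\ell k\ln k+k\bigl((\ell-1)\ln n-\ell\ln(\ell-1)+\ell+\ln\mathcal{K}_\ell\bigr), \] so that $\mathscr{S}_2(n,k)=-2k\ln k+k\bigl(\ln n+2+\ln\zeta(2)\bigr)$. Theorem. Let \[ I_{1,\log}:=-\frac{\zeta(0)}{\zeta(2)}=\frac{3}{\pi^2},\qquad I_1:=\frac{\zeta'(0)}{\zeta(2)}=-\frac{3\ln(2\pi)}{\pi^2},\qquad \mathscr{E}_2(u):=I_{1,\log}\,u\ln u+I_1\,u . \] Then for every $s\in(0,1)$ and every sequence of integers $(k_n)_{n\ge 1}$ with $1\le k_n\le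 n$ and $k_n\sim s\,n^{1/2}$ as $n\to\infty$, we have \[ A(2,n,k_n)\sim\frac{1}{2\pi}\,(n-1)!\,\exp\left(\mathscr{S}_2(n,k_n)+k_n\,\mathscr{E}_2\!\left(\frac{k_n}{n}\right)\right)\qquad(n\to\infty). \] Here $f(n)\sim g(n)$ means that $f(n)/g(n)\to 1$ as $n\to\infty$. -/

import Mathlib

open Filter Topology Asymptotics

namespace CommPerm

/-- The number of joint orbits of a tuple of permutations of an `n`-element set, i.e. of orbits
of the subgroup that the tuple generates. -/
noncomputable def jointOrbits {ℓ n : ℕ} (σ : Fin ℓ → Equiv.Perm (Fin n)) : ℕ :=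
  Nat.card (MulAction.orbitRel.Quotient (Subgroup.closure (Set.range σ)) (Fin n))

/-- `A ℓ n k` is the number of ordered `ℓ`-tuples of pairwise commuting permutations of an
`n`-element set with exactly `k` joint orbits. -/
noncomputable def A (ℓ n k : ℕ) : ℕ :=
  Nat.card {σ : Fin ℓ → Equiv.Perm (Fin n) //
    (∀ i j, Commute (σ i) (σ j)) ∧ jointOrbits σ = k}

/-- `K ℓ = (ℓ - 1)! ζ(2) ζ(3) ⋯ ζ(ℓ)` for `ℓ ≥ 1`. The zeta values are real, so that taking
real parts loses nothing. -/
noncomputable def K (ℓ : ℕ) : ℝ :=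
  ((ℓ - 1).factorial : ℝ) * ∏ j ∈ Finset.Icc 2 ℓ, (riemannZeta (j : ℂ)).re

/-- Starr's main term. -/
noncomputable def S (ℓ n k : ℕ) : ℝ :=
  -(ℓ : ℝ) * (k : ℝ) * Real.log k
    + (k : ℝ) * (((ℓ : ℝ) - 1) * Real.log n - (ℓ : ℝ) * Real.log ((ℓ : ℝ) - 1)
      + (ℓ : ℝ) + Real.log (K ℓ))

/-- The constant `I_{1,log}`. -/
noncomputable def I1log : ℝ := 3 / Real.pi ^ 2

/-- The constant `I_1`. -/
noncomputable def I1 : ℝ := -3 * Real.log (2 * Real.pi) / Real.pi ^ 2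

/-- The correction term for pairs of permutations. -/
noncomputable def E₂ (u : ℝ) : ℝ := I1log * (u * Real.log u) + I1 * u

end CommPerm

/-! Splitting a commuting pair into its joint orbits gives the exponential formula A(2,n,k) =
(n!/k!) [z^n] F(z)^k with F(z) = Σ σ(m) z^m / m, because m points carry (m-1)! σ(m) transitive
commuting pairs (`card_transPairs`, `A_two_eq_coeff`). Such a pair is a rectangular grid closed up
to a torus, with one free shift where the last row meets the first.

Since F(z) = -Σ log(1 - z^j), exp(-F) is Euler's product, and the modular transformation of the eta
function yields F(e^{-r}) = π²/(6r) + (1/2) log(r/2π) + o(1) as r → 0+ (`Fr_eq`, `tendsto_Fr_sub`).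

The coefficient is read off from Cauchy's formula on |z| = e^{-r} with r = k/n, the critical point
of (π²/(6r))^k e^{nr}. This is only the saddle point of the leading term, but it is accurate enough:
after θ = r x/√k the normalised integrand tends to exp(-x²/2), because t F(e^{-t}) varies slowly
(`tendsto_scaled`). It has an integrable majorant, because |F| drops by a definite factor off the
positive axis (`eventually_norm_evalF_le`). So the rescaled integral tends to √(2π).

With Stirling's formula for k!, the term π²/(6r) produces exp(S), and the relative correction (3/π²)
r log(r/2π), which is E₂(r), produces exp(k E₂(r)). As kr = k²/n stays bounded, all other
corrections to k log F(e^{-r}) are o(1) (`tendsto_mul_log_sub`). -/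

namespace CommPerm

open Equiv

/-! ### Joint orbits and invariant sets. -/

section Orbits

variable {α β : Type*}

/-- A set is invariant under a pair of permutations. -/
def Invariant (p : Perm α × Perm α) (s : Set α) : Prop :=
  ∀ x, (p.1 x ∈ s ↔ x ∈ s) ∧ (p.2 x ∈ s ↔ x ∈ s)

/-- The number of joint orbits of a pair of permutations. -/
noncomputable def numOrbits (p : Perm α × Perm α) : ℕ :=
  Nat.card (MulAction.orbitRel.Quotient (Subgroup.closure {p.1, p.2}) α)

/-- The joint orbit of a point, as the smallest invariant set that contains it. -/
def orb (p : Perm α × Perm α) (x : α) : Set α :=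
  {y | ∀ s, Invariant p s → x ∈ s → y ∈ s}

lemma Invariant.mem_iff {p : Perm α × Perm α} {s : Set α} (hs : Invariant p s) {g : Perm α}
    (hg : g ∈ Subgroup.closure {p.1, p.2}) : ∀ x, g x ∈ s ↔ x ∈ s := by
  induction hg using Subgroup.closure_induction with
  | mem g hg =>
    intro x
    rcases hg with rfl | rfl
    · exact (hs x).1
    · exact (hs x).2
  | one => simp
  | mul g h _ _ ihg ihh => intro x; rw [Perm.mul_apply, ihg, ihh]
  | inv g _ ih => intro x; rw [← ih (g⁻¹ x)]; simp

lemma Invariant.compl {p : Perm α × Perm α} {s : Set α} (hs : Invariant p s) :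
    Invariant p sᶜ := fun x => ⟨not_congr (hs x).1, not_congr (hs x).2⟩

/-- Invariant sets are the same as sets of orbits. -/
def invariantEquiv (p : Perm α × Perm α) :
    {s : Set α // Invariant p s} ≃
      Set (MulAction.orbitRel.Quotient (Subgroup.closure {p.1, p.2}) α) where
  toFun s := {q | ∃ x ∈ s.1, Quotient.mk _ x = q}
  invFun t := ⟨{x | (Quotient.mk _ x : MulAction.orbitRel.Quotient _ α) ∈ t}, by
    have key : ∀ g ∈ Subgroup.closure {p.1, p.2}, ∀ x,
        (Quotient.mk _ (g x) : MulAction.orbitRel.Quotient (Subgroup.closure {p.1, p.2}) α)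
          = Quotient.mk _ x := fun g hg x => Quotient.sound ⟨⟨g, hg⟩, rfl⟩
    intro x
    constructor
    · simp only [Set.mem_ofPred_eq]
      rw [key p.1 (Subgroup.subset_closure (by simp))]
    · simp only [Set.mem_ofPred_eq]
      rw [key p.2 (Subgroup.subset_closure (by simp))]⟩
  left_inv := by
    rintro ⟨s, hs⟩
    ext x
    constructor
    · rintro ⟨y, hy, h⟩
      obtain ⟨⟨g, hg⟩, h⟩ := Quotient.exact h
      change g x = y at h
      rw [← hs.mem_iff hg, h]
      exact hy
    · intro h
      exact ⟨x, h, rfl⟩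
  right_inv := by
    intro t
    ext q
    constructor
    · rintro ⟨x, hx, rfl⟩
      exact hx
    · induction q using Quotient.inductionOn with
      | h x => exact fun h => ⟨x, h, rfl⟩

/-- Counting invariant sets determines the number of orbits, so identities for `numOrbits` follow
from bijections between invariant sets, without handling quotients. -/
lemma card_invariant [Finite α] (p : Perm α × Perm α) :
    Nat.card {s : Set α // Invariant p s} = 2 ^ numOrbits p := by
  rw [Nat.card_congr (invariantEquiv p), numOrbits]
  have : Finite (MulAction.orbitRel.Quotient (Subgroup.closure {p.1, p.2}) α) :=
    Quotient.finite _
  have := Fintype.ofFinite (MulAction.orbitRel.Quotient (Subgroup.closure {p.1, p.2}) α)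
  rw [Nat.card_eq_fintype_card, Nat.card_eq_fintype_card, Fintype.card_set]

lemma numOrbits_eq_of_equiv [Finite α] [Finite β] {p : Perm α × Perm α} {q : Perm β × Perm β}
    (e : {s : Set α // Invariant p s} ≃ {s : Set β // Invariant q s}) :
    numOrbits p = numOrbits q := by
  have := Nat.card_congr e
  rw [card_invariant, card_invariant] at this
  exact Nat.pow_right_injective le_rfl this

lemma mem_orb (p : Perm α × Perm α) (x : α) : x ∈ orb p x := fun _ _ h => h

lemma orb_subset {p : Perm α × Perm α} {x : α} {s : Set α} (hs : Invariant p s) (hx : x ∈ s) :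
    orb p x ⊆ s := fun _ hy => hy s hs hx

lemma invariant_orb (p : Perm α × Perm α) (x : α) : Invariant p (orb p x) := fun y =>
  ⟨⟨fun h s hs hx => (hs y).1.1 (h s hs hx), fun h s hs hx => (hs y).1.2 (h s hs hx)⟩,
   ⟨fun h s hs hx => (hs y).2.1 (h s hs hx), fun h s hs hx => (hs y).2.2 (h s hs hx)⟩⟩

/-- An invariant set or its complement contains `x`, hence everything; so there are just two
invariant sets. -/
lemma numOrbits_eq_one [Finite α] {p : Perm α × Perm α} {x : α} (h : orb p x = Set.univ) :
    numOrbits p = 1 := by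
  have h2 : Nat.card {s : Set α // Invariant p s} = 2 := by
    rw [Nat.card_eq_two_iff]
    refine ⟨⟨∅, fun x => by simp⟩, ⟨Set.univ, fun x => by simp⟩, ?_, ?_⟩
    · intro h
      have : Nonempty α := ⟨x⟩
      exact Set.empty_ne_univ (congrArg Subtype.val h)
    · rw [Set.eq_univ_iff_forall]
      rintro ⟨s, hs⟩
      by_cases hx : x ∈ s
      · right
        have : s = Set.univ := Set.univ_subset_iff.1 (h ▸ orb_subset hs hx)
        simp [this]
      · left
        have : sᶜ = Set.univ := Set.univ_subset_iff.1 (h ▸ orb_subset hs.compl hx)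
        exact Subtype.ext (by simpa using this)
  rw [card_invariant] at h2
  exact Nat.pow_right_injective le_rfl (h2.trans (pow_one 2).symm)

variable {S : Set α} [DecidablePred (· ∈ S)]

/-- Glue pairs of permutations of a set and of its complement. -/
def glue (p : Perm {x // x ∈ S} × Perm {x // x ∈ S}) (q : Perm {x // x ∉ S} × Perm {x // x ∉ S}) :
    Perm α × Perm α :=
  (p.1.subtypeCongr q.1, p.2.subtypeCongr q.2)

lemma invariant_glue_iff (p : Perm {x // x ∈ S} × Perm {x // x ∈ S})
    (q : Perm {x // x ∉ S} × Perm {x // x ∉ S}) (s : Set α) :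
    Invariant (glue p q) s ↔ Invariant p (Subtype.val ⁻¹' s) ∧ Invariant q (Subtype.val ⁻¹' s) := by
  constructor
  · intro h
    constructor
    · intro x
      simpa [glue] using h x.1
    · intro x
      simpa [glue] using h x.1
  · rintro ⟨h1, h2⟩ x
    by_cases hx : x ∈ S
    · simpa [glue, Perm.subtypeCongr.left_apply, hx] using h1 ⟨x, hx⟩
    · simpa [glue, Perm.subtypeCongr.right_apply, hx] using h2 ⟨x, hx⟩

/-- Invariant sets of a glued pair. -/
def invariantGlueEquiv (p : Perm {x // x ∈ S} × Perm {x // x ∈ S})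
    (q : Perm {x // x ∉ S} × Perm {x // x ∉ S}) :
    {s : Set α // Invariant (glue p q) s} ≃
      {s : Set {x // x ∈ S} // Invariant p s} × {s : Set {x // x ∉ S} // Invariant q s} where
  toFun s := (⟨_, ((invariant_glue_iff p q s.1).1 s.2).1⟩, ⟨_, ((invariant_glue_iff p q s.1).1 s.2).2⟩)
  invFun t := ⟨Subtype.val '' t.1.1 ∪ Subtype.val '' t.2.1, by
    rw [invariant_glue_iff]
    constructor
    · convert t.1.2
      ext x
      simp [x.2]
    · convert t.2.2
      ext x
      simp [x.2]⟩
  left_inv := by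
    rintro ⟨s, hs⟩
    ext x
    by_cases hx : x ∈ S <;> simp [hx]
  right_inv := by
    rintro ⟨⟨s, hs⟩, ⟨t, ht⟩⟩
    ext x
    · simp [x.2]
    · simp [x.2]

lemma numOrbits_glue [Finite α] (p : Perm {x // x ∈ S} × Perm {x // x ∈ S})
    (q : Perm {x // x ∉ S} × Perm {x // x ∉ S}) :
    numOrbits (glue p q) = numOrbits p + numOrbits q := by
  have := Nat.card_congr (invariantGlueEquiv p q)
  rw [Nat.card_prod, card_invariant, card_invariant, card_invariant, ← pow_add] at this
  exact Nat.pow_right_injective le_rfl this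

lemma orb_glue_eq_iff (p : Perm {x // x ∈ S} × Perm {x // x ∈ S})
    (q : Perm {x // x ∉ S} × Perm {x // x ∉ S}) {x : α} (hx : x ∈ S) :
    orb (glue p q) x = S ↔ orb p ⟨x, hx⟩ = Set.univ := by
  have hS : Invariant (glue p q) S := by
    rw [invariant_glue_iff]
    exact ⟨fun x => by simp, fun x => by simp [(q.1 x).2, (q.2 x).2, x.2]⟩
  constructor
  · intro h
    rw [Set.eq_univ_iff_forall]
    intro y s hs hxs
    have : y.1 ∈ orb (glue p q) x := by rw [h]; exact y.2
    have h2 := this (Subtype.val '' s) (by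
      rw [invariant_glue_iff]
      refine ⟨by simpa [Set.preimage_image_eq _ Subtype.val_injective] using hs, fun z => ?_⟩
      have : ∀ z : {x // x ∉ S}, z ∉ (Subtype.val ⁻¹' (Subtype.val '' s) : Set {x // x ∉ S}) := by
        rintro z ⟨w, -, hw⟩
        exact z.2 (hw ▸ w.2)
      simp only [this]
      simp) ⟨_, hxs, rfl⟩
    obtain ⟨z, hz, hzy⟩ := h2
    exact Subtype.val_injective hzy ▸ hz
  · intro h
    refine (orb_subset hS hx).antisymm fun y hy s hs hxs => ?_
    have : (⟨y, hy⟩ : {x // x ∈ S}) ∈ orb p ⟨x, hx⟩ := h ▸ Set.mem_univ _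
    exact this (Subtype.val ⁻¹' s) ((invariant_glue_iff p q s).1 hs).1 hxs

lemma commute_glue_iff (p : Perm {x // x ∈ S} × Perm {x // x ∈ S})
    (q : Perm {x // x ∉ S} × Perm {x // x ∉ S}) :
    Commute (glue p q).1 (glue p q).2 ↔ Commute p.1 p.2 ∧ Commute q.1 q.2 := by
  have h1 : ∀ (a c : Perm {x // x ∈ S}) (b d : Perm {x // x ∉ S}),
      a.subtypeCongr b * c.subtypeCongr d = (a * c).subtypeCongr (b * d) := by
    intro a c b d
    exact ((Perm.subtypeCongrHom (· ∈ S)).map_mul (a, b) (c, d)).symm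
  unfold Commute SemiconjBy glue
  simp only [h1]
  constructor
  · intro h
    have := Perm.subtypeCongrHom_injective (· ∈ S) (a₁ := (p.1 * p.2, q.1 * q.2))
      (a₂ := (p.2 * p.1, q.2 * q.1)) h
    simpa using this
  · rintro ⟨h1, h2⟩
    rw [h1, h2]

lemma exists_glue {p : Perm α × Perm α} (h : Invariant p S) : ∃ q q', glue (S := S) q q' = p := by
  refine ⟨(p.1.subtypePerm fun x => (h x).1, p.2.subtypePerm fun x => (h x).2),
    (p.1.subtypePerm fun x => not_congr (h x).1, p.2.subtypePerm fun x => not_congr (h x).2), ?_⟩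
  ext x
  · by_cases hx : x ∈ S
    · simp [glue, Perm.subtypeCongr.left_apply, hx]
    · simp [glue, Perm.subtypeCongr.right_apply, hx]
  · by_cases hx : x ∈ S
    · simp [glue, Perm.subtypeCongr.left_apply, hx]
    · simp [glue, Perm.subtypeCongr.right_apply, hx]

lemma glue_injective {p p' : Perm {x // x ∈ S} × Perm {x // x ∈ S}}
    {q q' : Perm {x // x ∉ S} × Perm {x // x ∉ S}} (h : glue p q = glue p' q') :
    p = p' ∧ q = q' := by
  have h1 := Perm.subtypeCongrHom_injective (· ∈ S) (a₁ := (p.1, q.1))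
      (a₂ := (p'.1, q'.1)) (congrArg Prod.fst h)
  have h2 := Perm.subtypeCongrHom_injective (· ∈ S) (a₁ := (p.2, q.2))
      (a₂ := (p'.2, q'.2)) (congrArg Prod.snd h)
  simp only [Prod.mk.injEq] at h1 h2
  exact ⟨Prod.ext h1.1 h2.1, Prod.ext h1.2 h2.2⟩

end Orbits

/-! ### Counting pairs by the orbit of a distinguished point. -/

section Counting

variable {α β : Type*}

/-- Commuting pairs of permutations with `k` joint orbits. -/
def Pairs (α : Type*) (k : ℕ) : Type _ :=
  {p : Perm α × Perm α // Commute p.1 p.2 ∧ numOrbits p = k}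

/-- Commuting pairs of permutations for which the joint orbit of `x` is everything. -/
def TransPairs (α : Type*) (x : α) : Type _ :=
  {p : Perm α × Perm α // Commute p.1 p.2 ∧ orb p x = Set.univ}

lemma invariant_permCongr_iff (e : α ≃ β) (p : Perm α × Perm α) (s : Set β) :
    Invariant (e.permCongr p.1, e.permCongr p.2) s ↔ Invariant p (e ⁻¹' s) := by
  constructor
  · intro h x
    simpa using h (e x)
  · intro h x
    simpa using h (e.symm x)

lemma numOrbits_permCongr [Finite α] [Finite β] (e : α ≃ β) (p : Perm α × Perm α) :
    numOrbits (e.permCongr p.1, e.permCongr p.2) = numOrbits p :=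
  numOrbits_eq_of_equiv
    { toFun := fun s => ⟨e ⁻¹' s.1, (invariant_permCongr_iff e p s.1).1 s.2⟩
      invFun := fun s => ⟨e.symm ⁻¹' s.1, by
        rw [invariant_permCongr_iff]
        convert s.2
        ext; simp⟩
      left_inv := fun s => by ext; simp
      right_inv := fun s => by ext; simp }

lemma commute_permCongr_iff (e : α ≃ β) (p q : Perm α) :
    Commute (e.permCongr p) (e.permCongr q) ↔ Commute p q := by
  unfold Commute SemiconjBy
  rw [← Equiv.permCongr_mul, ← Equiv.permCongr_mul]
  exact e.permCongr.apply_eq_iff_eq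

lemma card_pairs_congr [Finite α] [Finite β] (e : α ≃ β) (k : ℕ) :
    Nat.card (Pairs α k) = Nat.card (Pairs β k) := by
  refine Nat.card_congr (Equiv.subtypeEquiv (e.permCongr.prodCongr e.permCongr) ?_)
  rintro ⟨a, b⟩
  simp [commute_permCongr_iff, ← numOrbits_permCongr e]

lemma A_two_eq (n k : ℕ) : A 2 n k = Nat.card (Pairs (Fin n) k) := by
  refine Nat.card_congr (Equiv.subtypeEquiv (finTwoArrowEquiv _) ?_)
  intro σ
  have hr : Set.range σ = {σ 0, σ 1} := by
    ext; simp [Fin.exists_fin_two, eq_comm]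
  have h2 : numOrbits (finTwoArrowEquiv _ σ) = jointOrbits σ := by
    unfold numOrbits jointOrbits
    rw [hr]
    rfl
  rw [h2]
  refine and_congr_left fun _ => ?_
  simp only [finTwoArrowEquiv_apply, Fin.forall_fin_two]
  constructor
  · exact fun h => h.1.2
  · exact fun h => ⟨⟨Commute.refl _, h⟩, ⟨h.symm, Commute.refl _⟩⟩

/-- Pairs of permutations such that the joint orbit of `x` is the set `S`. -/
lemma card_pairs_orb_eq [Finite α] (x : α) (S : Set α) (hx : x ∈ S) (k : ℕ) :
    Nat.card {p : Perm α × Perm α // (Commute p.1 p.2 ∧ numOrbits p = k + 1) ∧ orb p x = S} =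
      Nat.card (TransPairs {y // y ∈ S} ⟨x, hx⟩) * Nat.card (Pairs {y // y ∉ S} k) := by
  classical
  rw [← Nat.card_prod]
  symm
  refine Nat.card_congr (Equiv.ofBijective
    (fun t => ⟨glue t.1.1 t.2.1, ⟨(commute_glue_iff _ _).2 ⟨t.1.2.1, t.2.2.1⟩, ?_⟩, ?_⟩) ⟨?_, ?_⟩)
  · rw [numOrbits_glue, t.2.2.2, numOrbits_eq_one t.1.2.2, add_comm]
  · exact (orb_glue_eq_iff _ _ hx).2 t.1.2.2
  · rintro ⟨⟨p, hp⟩, ⟨q, hq⟩⟩ ⟨⟨p', hp'⟩, ⟨q', hq'⟩⟩ h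
    have := glue_injective (congrArg Subtype.val h)
    simp only at this
    obtain ⟨rfl, rfl⟩ := this
    rfl
  · rintro ⟨p, ⟨hc, hk⟩, ho⟩
    have hS : Invariant p S := ho ▸ invariant_orb p x
    obtain ⟨q, q', rfl⟩ := exists_glue hS
    rw [orb_glue_eq_iff _ _ hx] at ho
    rw [commute_glue_iff] at hc
    rw [numOrbits_glue, numOrbits_eq_one ho, add_comm, Nat.succ_inj] at hk
    exact ⟨(⟨q, hc.1, ho⟩, ⟨q', hc.2, hk⟩), rfl⟩

/-- The orbit of `x` consists of `x` and `m` of the other points. The pair is transitive on it and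
arbitrary, with `k` orbits, on the rest. -/
lemma card_pairs_succ [Fintype α] [DecidableEq α] (x : α) (k : ℕ) (T : ℕ → ℕ)
    (hT : ∀ (S : Set α) (hx : x ∈ S),
      Nat.card (TransPairs {y // y ∈ S} ⟨x, hx⟩) = T (Nat.card {y // y ∈ S})) :
    Nat.card (Pairs α (k + 1)) = ∑ m ∈ Finset.range (Fintype.card α),
      (Fintype.card α - 1).choose m *
        (T (m + 1) * Nat.card (Pairs (Fin (Fintype.card α - 1 - m)) k)) := by
  classical
  have h1 : Nat.card (Pairs α (k + 1)) = ∑ S : Finset α,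
      Nat.card {p : Perm α × Perm α // (Commute p.1 p.2 ∧ numOrbits p = k + 1) ∧
        orb p x = (S : Set α)} := by
    rw [← Nat.card_sigma]
    refine Nat.card_congr ?_
    refine ((Equiv.sigmaFiberEquiv (fun p : Pairs α (k + 1) => (orb p.1 x).toFinset)).symm).trans ?_
    refine Equiv.sigmaCongrRight fun S => ?_
    refine (Equiv.subtypeSubtypeEquivSubtypeInter
      (fun p : Perm α × Perm α => Commute p.1 p.2 ∧ numOrbits p = k + 1)
      (fun p => (orb p x).toFinset = S)).trans (Equiv.subtypeEquivRight fun p => ?_)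
    refine and_congr_right fun _ => ?_
    rw [← Finset.coe_inj, Set.coe_toFinset]
  have h2 : ∀ S : Finset α, Nat.card {p : Perm α × Perm α //
      (Commute p.1 p.2 ∧ numOrbits p = k + 1) ∧ orb p x = (S : Set α)} =
      if x ∈ S then T S.card * Nat.card (Pairs (Fin (Fintype.card α - S.card)) k) else 0 := by
    intro S
    split_ifs with hx
    · rw [card_pairs_orb_eq x (S : Set α) hx, hT]
      congr 1
      · congr 1
        simp
      · refine card_pairs_congr (Fintype.equivFinOfCardEq ?_) k
        rw [Fintype.card_subtype_compl]
        simp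
    · rw [Nat.card_eq_zero]
      left
      constructor
      rintro ⟨p, -, hp⟩
      exact hx (by rw [← Finset.mem_coe, ← hp]; exact mem_orb p x)
  rw [h1, Finset.sum_congr rfl fun S _ => h2 S, ← Finset.powerset_univ,
    ← Finset.insert_erase (Finset.mem_univ x),
    Finset.sum_powerset_insert (Finset.notMem_erase x _)]
  rw [Finset.sum_eq_zero, zero_add]
  · have : ∀ S ∈ (Finset.univ.erase x).powerset,
      (if x ∈ insert x S then T (insert x S).card *
        Nat.card (Pairs (Fin (Fintype.card α - (insert x S).card)) k) else 0) =
        (fun m => T (m + 1) * Nat.card (Pairs (Fin (Fintype.card α - 1 - m)) k)) S.card := by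
      intro S hS
      have hx : x ∉ S := fun h => by
        simpa using Finset.mem_powerset.1 hS h
      rw [if_pos (Finset.mem_insert_self _ _), Finset.card_insert_of_notMem hx,
        show Fintype.card α - (S.card + 1) = Fintype.card α - 1 - S.card by omega]
    rw [Finset.sum_congr rfl this, Finset.sum_powerset_apply_card
        (fun m => T (m + 1) * Nat.card (Pairs (Fin (Fintype.card α - 1 - m)) k)),
      Finset.card_erase_of_mem (Finset.mem_univ x), Finset.card_univ,
      Nat.sub_add_cancel (Fintype.card_pos_iff.2 ⟨x⟩)]
    simp
  · intro S hS
    rw [if_neg]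
    intro h
    simpa using Finset.mem_powerset.1 hS h

end Counting

/-! ### Classification of transitive commuting pairs. -/

section Model

open scoped Fin.NatCast

variable {α : Type*} {e d : ℕ}

/-- The standard transitive pair: a rotation of the columns, and a rotation of the rows that shifts
the last row by `c`. -/
def model (e d : ℕ) (c : Fin (d + 1)) :
    Perm (Fin (e + 1) × Fin (d + 1)) × Perm (Fin (e + 1) × Fin (d + 1)) :=
  (Equiv.prodShear (Equiv.refl _) fun _ => Equiv.addRight 1,
   Equiv.prodShear (Equiv.addRight 1) fun i =>
    if i = Fin.last e then Equiv.addRight c else Equiv.refl _)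

lemma model_fst_apply (c : Fin (d + 1)) (i : Fin (e + 1)) (j : Fin (d + 1)) :
    (model e d c).1 (i, j) = (i, j + 1) := rfl

lemma model_snd_apply (c : Fin (d + 1)) (i : Fin (e + 1)) (j : Fin (d + 1)) :
    (model e d c).2 (i, j) = (i + 1, if i = Fin.last e then j + c else j) := by
  by_cases h : i = Fin.last e <;> simp [model, h]

lemma commute_model (c : Fin (d + 1)) : Commute (model e d c).1 (model e d c).2 := by
  ext1 ⟨i, j⟩
  simp only [Perm.mul_apply, model_fst_apply, model_snd_apply]
  split_ifs
  · rw [add_right_comm]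
  · rfl

lemma model_fst_pow (c : Fin (d + 1)) (i : Fin (e + 1)) (j : Fin (d + 1)) (n : ℕ) :
    ((model e d c).1 ^ n) (i, j) = (i, j + (n : Fin (d + 1))) := by
  induction n with
  | zero => simp
  | succ n ih =>
    rw [pow_succ', Perm.mul_apply, ih, model_fst_apply, Nat.cast_succ, add_assoc]

lemma model_snd_pow (c : Fin (d + 1)) (j : Fin (d + 1)) (n : ℕ) (hn : n ≤ e) :
    ((model e d c).2 ^ n) (0, j) = ((n : Fin (e + 1)), j) := by
  induction n with
  | zero => simp
  | succ n ih =>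
    rw [pow_succ', Perm.mul_apply, ih (by omega), model_snd_apply, if_neg, Nat.cast_succ]
    intro h
    have := congrArg Fin.val h
    simp only [Fin.val_last, Fin.val_natCast] at this
    rw [Nat.mod_eq_of_lt (by omega)] at this
    omega

/-- One full turn through the rows leaves exactly the shift, so `c` can be recovered from the pair.
-/
lemma model_snd_pow_succ (c : Fin (d + 1)) :
    ((model e d c).2 ^ (e + 1)) (0, 0) = (0, c) := by
  rw [pow_succ', Perm.mul_apply, model_snd_pow c 0 e le_rfl, model_snd_apply, if_pos]
  · simp
  · simp

lemma model_pow_apply (c : Fin (d + 1)) (i : Fin (e + 1)) (j : Fin (d + 1)) :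
    ((model e d c).2 ^ i.val) (((model e d c).1 ^ j.val) (0, 0)) = (i, j) := by
  rw [model_fst_pow, model_snd_pow c _ _ (by omega)]
  simp

lemma Invariant.pow_fst {p : Perm α × Perm α} {s : Set α} (hs : Invariant p s) (n : ℕ) (x : α) :
    (p.1 ^ n) x ∈ s ↔ x ∈ s :=
  hs.mem_iff (Subgroup.pow_mem _ (Subgroup.subset_closure (by simp)) n) x

lemma Invariant.pow_snd {p : Perm α × Perm α} {s : Set α} (hs : Invariant p s) (n : ℕ) (x : α) :
    (p.2 ^ n) x ∈ s ↔ x ∈ s :=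
  hs.mem_iff (Subgroup.pow_mem _ (Subgroup.subset_closure (by simp)) n) x

/-- The pair of permutations obtained from the standard pair by a labelling. -/
def labelled (c : Fin (d + 1)) (f : Fin (e + 1) × Fin (d + 1) ≃ α) : Perm α × Perm α :=
  (f.permCongr (model e d c).1, f.permCongr (model e d c).2)

lemma labelled_fst_pow (c : Fin (d + 1)) (f : Fin (e + 1) × Fin (d + 1) ≃ α) (n : ℕ)
    (z : Fin (e + 1) × Fin (d + 1)) :
    ((labelled c f).1 ^ n) (f z) = f (((model e d c).1 ^ n) z) := by
  induction n with
  | zero => simp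
  | succ n ih =>
    rw [pow_succ', Perm.mul_apply, ih, pow_succ', Perm.mul_apply]
    simp [labelled]

lemma labelled_snd_pow (c : Fin (d + 1)) (f : Fin (e + 1) × Fin (d + 1) ≃ α) (n : ℕ)
    (z : Fin (e + 1) × Fin (d + 1)) :
    ((labelled c f).2 ^ n) (f z) = f (((model e d c).2 ^ n) z) := by
  induction n with
  | zero => simp
  | succ n ih =>
    rw [pow_succ', Perm.mul_apply, ih, pow_succ', Perm.mul_apply]
    simp [labelled]

lemma labelled_pow_apply (c : Fin (d + 1)) (f : Fin (e + 1) × Fin (d + 1) ≃ α)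
    (i : Fin (e + 1)) (j : Fin (d + 1)) :
    ((labelled c f).2 ^ i.val) (((labelled c f).1 ^ j.val) (f (0, 0))) = f (i, j) := by
  rw [labelled_fst_pow, labelled_snd_pow, model_pow_apply]

lemma commute_labelled (c : Fin (d + 1)) (f : Fin (e + 1) × Fin (d + 1) ≃ α) :
    Commute (labelled c f).1 (labelled c f).2 :=
  (commute_permCongr_iff f _ _).2 (commute_model c)

lemma orb_labelled (c : Fin (d + 1)) (f : Fin (e + 1) × Fin (d + 1) ≃ α) :
    orb (labelled c f) (f (0, 0)) = Set.univ := by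
  rw [Set.eq_univ_iff_forall]
  intro y s hs hx
  obtain ⟨⟨i, j⟩, rfl⟩ := f.surjective y
  rw [← labelled_pow_apply c, hs.pow_snd, hs.pow_fst]
  exact hx

/-- The pair `p` is a labelled standard pair, where `x` has the label `(0, 0)`. -/
def IsModel (x : α) (e d c : ℕ) (p : Perm α × Perm α) : Prop :=
  ∃ (hc : c < d + 1) (f : Fin (e + 1) × Fin (d + 1) ≃ α),
    f (0, 0) = x ∧ labelled ⟨c, hc⟩ f = p

/-- Every point is reached from the base point by powers of the two permutations, so the pair and
the base point determine the labelling. -/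
lemma labelled_injective (c : Fin (d + 1)) {f g : Fin (e + 1) × Fin (d + 1) ≃ α}
    (h0 : f (0, 0) = g (0, 0)) (h : labelled c f = labelled c g) : f = g := by
  ext ⟨i, j⟩
  rw [← labelled_pow_apply c f, ← labelled_pow_apply c g, h, h0]

lemma card_equiv_apply_eq {γ : Type*} [Fintype α] [Fintype γ] (h : Fintype.card γ = Fintype.card α)
    (z : γ) (x : α) : Nat.card {f : γ ≃ α // f z = x} = (Fintype.card α - 1).factorial := by
  classical
  let g0 : γ ≃ α := Fintype.equivOfCardEq h
  let g : γ ≃ α := g0.trans (Equiv.swap (g0 z) x)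
  have hg : g z = x := by simp [g]
  have e1 : {f : γ ≃ α // f z = x} ≃ {p : Perm α // ∀ a, ¬ (a ≠ x) → p a = a} :=
    Equiv.subtypeEquiv (g.equivCongr (Equiv.refl α)) (by
      intro f
      have : g.symm x = z := by rw [← hg]; simp
      simp [this])
  rw [Nat.card_congr (e1.trans (Equiv.Perm.subtypeEquivSubtypePerm (· ≠ x)).symm),
    Nat.card_eq_fintype_card, Fintype.card_perm]
  congr 1
  simp

lemma card_isModel [Fintype α] (x : α) {e d c : ℕ} (hc : c < d + 1)
    (h : (e + 1) * (d + 1) = Fintype.card α) :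
    Nat.card {p : Perm α × Perm α // IsModel x e d c p} = (Fintype.card α - 1).factorial := by
  rw [← card_equiv_apply_eq (γ := Fin (e + 1) × Fin (d + 1)) (by simpa using h) (0, 0) x]
  symm
  refine Nat.card_congr (Equiv.ofBijective (fun f => ⟨labelled ⟨c, hc⟩ f.1, hc, f.1, f.2, rfl⟩) ⟨?_, ?_⟩)
  · rintro ⟨f, hf⟩ ⟨g, hg⟩ h
    exact Subtype.ext (labelled_injective ⟨c, hc⟩ (hf.trans hg.symm) (congrArg Subtype.val h))
  · rintro ⟨p, hc', f, hf, rfl⟩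
    exact ⟨⟨f, hf⟩, rfl⟩

lemma IsModel.pow_apply_eq_iff {x : α} {e d c : ℕ} {p : Perm α × Perm α} (h : IsModel x e d c p)
    (n : ℕ) : (p.1 ^ n) x = x ↔ d + 1 ∣ n := by
  obtain ⟨hc, f, rfl, rfl⟩ := h
  rw [labelled_fst_pow, f.apply_eq_iff_eq, model_fst_pow]
  simp [Fin.natCast_eq_zero]

/-- The parameters are intrinsic: `d + 1` is the period of `x` under the first permutation, `e`
follows from the cardinality, and `c` says where the `(e + 1)`-st power of the second one sends `x`.
-/
lemma IsModel.unique [Fintype α] {x : α} {e d c e' d' c' : ℕ} {p : Perm α × Perm α}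
    (h : IsModel x e d c p) (h' : IsModel x e' d' c' p) : e = e' ∧ d = d' ∧ c = c' := by
  have h1 : d + 1 = d' + 1 := Nat.dvd_antisymm
    ((h.pow_apply_eq_iff _).1 ((h'.pow_apply_eq_iff _).2 dvd_rfl))
    ((h'.pow_apply_eq_iff _).1 ((h.pow_apply_eq_iff _).2 dvd_rfl))
  obtain rfl : d = d' := by omega
  obtain ⟨hc, f, hf, hp⟩ := h
  obtain ⟨hc', f', hf', hp'⟩ := h'
  have h2 : (e + 1) * (d + 1) = (e' + 1) * (d + 1) := by
    have h3 := Fintype.card_congr f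
    have h4 := Fintype.card_congr f'
    simp only [Fintype.card_prod, Fintype.card_fin] at h3 h4
    rw [h3, h4]
  obtain rfl : e = e' := by
    have := Nat.eq_of_mul_eq_mul_right (Nat.succ_pos d) h2
    omega
  have h5 : (p.2 ^ (e + 1)) x = (p.1 ^ c) x := by
    rw [← hp, ← hf, labelled_snd_pow, labelled_fst_pow, model_snd_pow_succ, model_fst_pow]
    congr 2
    ext
    simp [Nat.mod_eq_of_lt hc]
  rw [← hp', ← hf', labelled_snd_pow, labelled_fst_pow, model_snd_pow_succ, model_fst_pow,
    f'.apply_eq_iff_eq] at h5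
  have h6 := congrArg (fun z => (z.2).val) h5
  simp [Nat.mod_eq_of_lt hc] at h6
  exact ⟨rfl, rfl, h6.symm⟩

lemma apply_mem_iff_of_mapsTo [Finite α] {a : Perm α} {s : Set α} (h : Set.MapsTo a s s) (x : α) :
    a x ∈ s ↔ x ∈ s := by
  refine ⟨fun hx => ?_, fun hx => h hx⟩
  have : a '' s = s := Set.eq_of_subset_of_ncard_le h.image_subset
    (Set.ncard_image_of_injective s a.injective).ge (Set.toFinite s)
  rw [← this] at hx
  exact a.injective.mem_set_image.1 hx

/-- Let `d + 1` be the period of `x` under `a`, and `e + 1` the least positive exponent for which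
that power of `b` brings `x` back into its `a`-cycle, at `a ^ c` applied to `x`. Then the points `b
^ i (a ^ j x)` form the grid: minimality makes them distinct, transitivity makes them exhaust the
set. -/
lemma exists_isModel [Finite α] {x : α} {p : Perm α × Perm α} (hc : Commute p.1 p.2)
    (ho : orb p x = Set.univ) : ∃ e d c, IsModel x e d c p := by
  classical
  obtain ⟨a, b⟩ := p
  simp only at hc
  have hper : 0 < Function.minimalPeriod a x := by
    apply Function.minimalPeriod_pos_of_mem_periodicPts
    refine ⟨orderOf a, orderOf_pos a, ?_⟩
    rw [Function.IsPeriodicPt, Function.IsFixedPt, Perm.iterate_eq_pow, pow_orderOf_eq_one]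
    rfl
  obtain ⟨d, hd⟩ := Nat.exists_eq_succ_of_ne_zero hper.ne'
  have hmod : ∀ n, (a ^ (n % (d + 1))) x = (a ^ n) x := by
    intro n
    have := Function.iterate_mod_minimalPeriod_eq (f := a) (x := x) (n := n)
    rwa [hd, Perm.iterate_eq_pow, Perm.iterate_eq_pow] at this
  have hinj : ∀ m n, m < d + 1 → n < d + 1 → (a ^ m) x = (a ^ n) x → m = n := by
    intro m n hm hn h
    rw [← Nat.succ_eq_add_one, ← hd] at hm hn
    apply Function.iterate_injOn_Iio_minimalPeriod (f := a) (x := x) hm hn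
    simpa only [Perm.iterate_eq_pow] using h
  have hex : ∃ e, ∃ j, (b ^ (e + 1)) x = (a ^ j) x := by
    obtain ⟨e, he⟩ := Nat.exists_eq_succ_of_ne_zero (orderOf_pos b).ne'
    refine ⟨e, 0, ?_⟩
    rw [← Nat.succ_eq_add_one, ← he, pow_orderOf_eq_one, pow_zero]
  obtain ⟨e, he, hmin⟩ : ∃ e, (∃ j, (b ^ (e + 1)) x = (a ^ j) x) ∧
      ∀ e' < e, ¬ ∃ j, (b ^ (e' + 1)) x = (a ^ j) x :=
    ⟨Nat.find hex, Nat.find_spec hex, fun _ h => Nat.find_min hex h⟩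
  obtain ⟨j0, hj0⟩ := he
  have hcomm : ∀ i j y, (a ^ j) ((b ^ i) y) = (b ^ i) ((a ^ j) y) := by
    intro i j y
    rw [← Perm.mul_apply, ← Perm.mul_apply, (hc.pow_pow j i).eq]
  set c := j0 % (d + 1) with hcdef
  have hcd : c < d + 1 := Nat.mod_lt _ (Nat.succ_pos d)
  have hbe : (b ^ (e + 1)) x = (a ^ c) x := by rw [hj0, hcdef, hmod]
  let g : Fin (e + 1) × Fin (d + 1) → α := fun z => (b ^ z.1.val) ((a ^ z.2.val) x)
  have ga : ∀ z, a (g z) = g ((model e d ⟨c, hcd⟩).1 z) := by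
    rintro ⟨i, j⟩
    simp only [g, model_fst_apply]
    have : ((j + 1 : Fin (d + 1)).val) = (j.val + 1) % (d + 1) := by
      simp [Fin.val_add]
    rw [this, hmod, pow_succ', Perm.mul_apply]
    simpa using hcomm i 1 ((a ^ j.val) x)
  have gb : ∀ z, b (g z) = g ((model e d ⟨c, hcd⟩).2 z) := by
    rintro ⟨i, j⟩
    simp only [g, model_snd_apply]
    rw [← Perm.mul_apply, ← pow_succ']
    split_ifs with hi
    · rw [hi, Fin.last_add_one]
      simp only [Fin.val_last, Fin.val_zero, pow_zero, Perm.one_apply, Fin.val_add]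
      rw [← hcomm, hbe, hmod (j.val + c), pow_add, Perm.mul_apply (a ^ j.val)]
    · rw [Fin.val_add_one_of_lt (Fin.lt_last_iff_ne_last.2 hi)]
  have gsurj : Function.Surjective g := by
    have hinv : Invariant (a, b) (Set.range g) := by
      have ha : Set.MapsTo a (Set.range g) (Set.range g) := by
        rintro _ ⟨z, rfl⟩
        exact ⟨_, (ga z).symm⟩
      have hb : Set.MapsTo b (Set.range g) (Set.range g) := by
        rintro _ ⟨z, rfl⟩
        exact ⟨_, (gb z).symm⟩
      exact fun y => ⟨apply_mem_iff_of_mapsTo ha y, apply_mem_iff_of_mapsTo hb y⟩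
    have := orb_subset hinv (x := x) ⟨(0, 0), by simp [g]⟩
    rw [ho, Set.univ_subset_iff] at this
    exact Set.range_eq_univ.1 this
  have key : ∀ i i' : Fin (e + 1), ∀ j j' : Fin (d + 1), i.val < i'.val → g (i, j) ≠ g (i', j') := by
    intro i i' j j' hlt h
    simp only [g] at h
    obtain ⟨m, hm⟩ := Nat.exists_eq_add_of_lt hlt
    rw [hm, add_assoc, pow_add, Perm.mul_apply, (b ^ i.val).apply_eq_iff_eq] at h
    -- Applying `a ^ (d + 1 - j')` to both sides cancels `a ^ j'`, since `a ^ (d + 1)` fixes `x`; a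
    -- power of `b` below `e + 1` would then bring `x` back too early.
    refine hmin m (by omega) ⟨d + 1 - j'.val + j.val, ?_⟩
    rw [pow_add a, Perm.mul_apply, h, hcomm, ← Perm.mul_apply (a ^ _), ← pow_add a,
      Nat.sub_add_cancel j'.2.le, ← hmod (d + 1), Nat.mod_self, pow_zero, Perm.one_apply]
  have ginj : Function.Injective g := by
    rintro ⟨i, j⟩ ⟨i', j'⟩ h
    have hi : i = i' := by
      rcases lt_trichotomy i.val i'.val with hlt | heq | hlt
      · exact absurd h (key _ _ _ _ hlt)
      · exact Fin.ext heq
      · exact absurd h.symm (key _ _ _ _ hlt)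
    subst hi
    simp only [g, EmbeddingLike.apply_eq_iff_eq] at h
    rw [Fin.ext (hinj _ _ j.2 j'.2 h)]
  have hf : ∀ z, Equiv.ofBijective g ⟨ginj, gsurj⟩ z = g z := fun z => rfl
  generalize Equiv.ofBijective g ⟨ginj, gsurj⟩ = f at hf
  refine ⟨e, d, c, hcd, f, by simp [hf, g], ?_⟩
  ext y
  · obtain ⟨z, rfl⟩ := gsurj y
    simp only [labelled, Equiv.permCongr_apply]
    rw [← hf z, f.symm_apply_apply, hf, hf, ga]
  · obtain ⟨z, rfl⟩ := gsurj y
    simp only [labelled, Equiv.permCongr_apply]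
    rw [← hf z, f.symm_apply_apply, hf, hf, gb]

/-- The pairs are the disjoint union, over factorisations `m = e * d` and shifts `c < d`, of classes
with `(m - 1)!` labellings each. Summing `d` over the factorisations gives σ(m). -/
lemma card_transPairs [Fintype α] (x : α) : Nat.card (TransPairs α x) =
    (Fintype.card α - 1).factorial * ArithmeticFunction.sigma 1 (Fintype.card α) := by
  classical
  set m := Fintype.card α with hm
  -- The sides are stored at their true size; `IsModel` takes them lowered by one, because its grid
  -- is indexed by `Fin (· + 1)`.
  let I : Finset (Σ _ : ℕ × ℕ, ℕ) :=
    (Nat.divisorsAntidiagonal m).sigma fun z => Finset.range z.2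
  have h1 : ∀ p : Perm α × Perm α, (Commute p.1 p.2 ∧ orb p x = Set.univ) ↔
      ∃ t ∈ I, IsModel x (t.1.1 - 1) (t.1.2 - 1) t.2 p := by
    intro p
    constructor
    · rintro ⟨hc, ho⟩
      obtain ⟨e, d, c, h⟩ := exists_isModel hc ho
      refine ⟨⟨(e + 1, d + 1), c⟩, ?_, h⟩
      obtain ⟨hc, f, -⟩ := h
      have := Fintype.card_congr f
      simp only [Fintype.card_prod, Fintype.card_fin] at this
      have : Nonempty α := ⟨x⟩
      simp [I, *]
    · rintro ⟨t, -, hc, f, rfl, rfl⟩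
      exact ⟨commute_labelled _ f, orb_labelled _ f⟩
  have h2 : Nat.card (TransPairs α x) =
      (I.biUnion fun t => Finset.univ.filter (IsModel x (t.1.1 - 1) (t.1.2 - 1) t.2)).card := by
    rw [TransPairs, Nat.card_eq_fintype_card, Fintype.card_subtype]
    congr 1
    ext p
    simp only [Finset.mem_filter_univ, Finset.mem_biUnion]
    exact h1 p
  rw [h2, Finset.card_biUnion]
  · have h3 : ∀ t ∈ I, (Finset.univ.filter (IsModel x (t.1.1 - 1) (t.1.2 - 1) t.2)).card =
        (m - 1).factorial := by
      rintro ⟨⟨e, d⟩, c⟩ ht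
      simp only [I, Finset.mem_sigma, Nat.mem_divisorsAntidiagonal, Finset.mem_range] at ht
      rw [← Fintype.card_subtype, ← Nat.card_eq_fintype_card, hm]
      have he : e ≠ 0 := by rintro rfl; simp at ht; omega
      refine card_isModel x (by simp only; omega) ?_
      simp only
      rw [Nat.sub_add_cancel (by omega), Nat.sub_add_cancel (by omega), ht.1.1]
    rw [Finset.sum_congr rfl h3, Finset.sum_const, smul_eq_mul, mul_comm, Finset.card_sigma]
    congr 1
    simp only [Finset.card_range]
    rw [Nat.sum_divisorsAntidiagonal' (f := fun _ d => d), ArithmeticFunction.sigma_one_apply]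
  · rintro ⟨⟨e, d⟩, c⟩ ht ⟨⟨e', d'⟩, c'⟩ ht' hne
    rw [Function.onFun, Finset.disjoint_left]
    intro p hp hp'
    simp only [Finset.mem_filter_univ] at hp hp'
    have := hp.unique hp'
    simp only [I, Finset.coe_sigma, Set.mem_sigma_iff, Finset.mem_coe,
      Nat.mem_divisorsAntidiagonal, Finset.mem_range] at ht ht'
    have he : e ≠ 0 := by rintro rfl; simp at ht; omega
    have he' : e' ≠ 0 := by rintro rfl; simp at ht'; omega
    apply hne
    obtain rfl : e = e' := by omega
    obtain rfl : d = d' := by omega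
    rw [this.2.2]

end Model

/-! ### The recurrence for A(2,n,k) and its initial values. -/

section Recurrence

lemma card_pairs_fin_succ (n k : ℕ) : Nat.card (Pairs (Fin (n + 1)) (k + 1)) =
    ∑ m ∈ Finset.range (n + 1), n.choose m * (m.factorial * ArithmeticFunction.sigma 1 (m + 1) *
      Nat.card (Pairs (Fin (n - m)) k)) := by
  classical
  have := card_pairs_succ (α := Fin (n + 1)) 0 k
    (fun m => (m - 1).factorial * ArithmeticFunction.sigma 1 m) (by
      intro S hx
      have := Fintype.ofFinite {y // y ∈ S}
      rw [card_transPairs, Nat.card_eq_fintype_card])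
  simpa using this

lemma A_two_succ_succ (n k : ℕ) : A 2 (n + 1) (k + 1) =
    ∑ m ∈ Finset.range (n + 1),
      n.choose m * (m.factorial * ArithmeticFunction.sigma 1 (m + 1) * A 2 (n - m) k) := by
  simp only [A_two_eq]
  exact card_pairs_fin_succ n k

lemma A_two_zero_zero : A 2 0 0 = 1 := by
  rw [A_two_eq, Pairs, Nat.card_eq_one_iff_unique]
  refine ⟨⟨fun a b => Subtype.ext (Subsingleton.elim _ _)⟩, ⟨⟨1, Commute.refl _, ?_⟩⟩⟩
  rw [numOrbits, Nat.card_eq_zero]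
  left
  exact ⟨fun q => Quotient.inductionOn q fun x => x.elim0⟩

lemma A_two_zero_succ (k : ℕ) : A 2 0 (k + 1) = 0 := by
  rw [A_two_eq, Pairs, Nat.card_eq_zero]
  left
  constructor
  rintro ⟨p, -, hp⟩
  have : numOrbits p = 0 := by
    rw [numOrbits, Nat.card_eq_zero]
    left
    exact ⟨fun q => Quotient.inductionOn q fun x => x.elim0⟩
  omega

lemma A_two_succ_zero (n : ℕ) : A 2 (n + 1) 0 = 0 := by
  rw [A_two_eq, Pairs, Nat.card_eq_zero]
  left
  constructor
  rintro ⟨p, -, hp⟩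
  rw [numOrbits, Nat.card_eq_zero] at hp
  rcases hp with h | h
  · exact h.elim (Quotient.mk _ (0 : Fin (n + 1)))
  · exact h.not_finite (Quotient.finite _)

end Recurrence

/-! ### The exponential formula. -/

section PowerSeries

open PowerSeries

/-- The exponential generating function of transitive commuting pairs. -/
noncomputable def F : PowerSeries ℝ :=
  PowerSeries.mk fun m => (ArithmeticFunction.sigma 1 m : ℝ) / m

/-- Marking a point corresponds to differentiation: the recurrence is the coefficient form of
(F^{k+1})' = (k+1) F' F^k. -/
lemma A_two_eq_coeff (n k : ℕ) :
    (A 2 n k : ℝ) = (n.factorial : ℝ) / k.factorial * coeff n (F ^ k) := by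
  induction n using Nat.strong_induction_on generalizing k with
  | _ n ih =>
    rcases n with _ | n
    · rcases k with _ | k
      · simp [A_two_zero_zero]
      · have : constantCoeff F = 0 := by simp [F]
        simp [A_two_zero_succ, this]
    · rcases k with _ | k
      · simp [A_two_succ_zero, coeff_one]
      · have hd : coeff n (d⁄dX ℝ (F ^ (k + 1))) = (k + 1) * ∑ m ∈ Finset.range (n + 1),
            (ArithmeticFunction.sigma 1 (m + 1) : ℝ) * coeff (n - m) (F ^ k) := by
          rw [Derivation.leibniz_pow]
          simp only [add_tsub_cancel_right, smul_eq_mul, nsmul_eq_mul]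
          have : ((k + 1 : ℕ) : PowerSeries ℝ) = C ((k : ℝ) + 1) := by simp
          rw [this, coeff_C_mul, mul_comm (F ^ k), coeff_mul,
            Finset.Nat.sum_antidiagonal_eq_sum_range_succ_mk]
          congr 1
          refine Finset.sum_congr rfl fun m _ => ?_
          simp only [coeff_derivative, F, coeff_mk]
          push_cast
          field_simp
        rw [coeff_derivative] at hd
        rw [A_two_succ_succ, Nat.factorial_succ n, Nat.factorial_succ k]
        push_cast
        have hk : ((k.factorial : ℕ) : ℝ) ≠ 0 := by positivity
        have hk1 : (k : ℝ) + 1 ≠ 0 := by positivity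
        calc _ = ∑ m ∈ Finset.range (n + 1), (n.factorial : ℝ) / k.factorial *
              ((ArithmeticFunction.sigma 1 (m + 1) : ℝ) * coeff (n - m) (F ^ k)) := by
              refine Finset.sum_congr rfl fun m hm => ?_
              rw [ih (n - m) (by omega), Nat.cast_choose ℝ (by simpa [Nat.lt_succ_iff] using hm)]
              have : ((m.factorial : ℕ) : ℝ) ≠ 0 := by positivity
              have : (((n - m).factorial : ℕ) : ℝ) ≠ 0 := by positivity
              field_simp
          _ = (n.factorial : ℝ) / k.factorial *
              (coeff (n + 1) (F ^ (k + 1)) * (n + 1) / (k + 1)) := by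
              rw [hd, ← Finset.mul_sum]
              field_simp
          _ = _ := by field_simp

end PowerSeries

/-! ### F as an analytic function in the unit disc, and Cauchy's formula. -/

open PowerSeries

/-- The value of the series `F` at a complex point. -/
noncomputable def evalF (z : ℂ) : ℂ := ∑' m : ℕ, ((coeff m F : ℝ) : ℂ) * z ^ m

lemma coeff_F (m : ℕ) : coeff m F = (ArithmeticFunction.sigma 1 m : ℝ) / m := coeff_mk _ _

lemma coeff_F_nonneg (m : ℕ) : 0 ≤ coeff m F := by
  rw [coeff_F]; positivity

lemma one_le_coeff_F {m : ℕ} (hm : m ≠ 0) : 1 ≤ coeff m F := by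
  rw [coeff_F, one_le_div (by positivity), Nat.cast_le, ArithmeticFunction.sigma_one_apply]
  exact Finset.single_le_sum (f := fun i => i) (fun _ _ => Nat.zero_le _)
    (Nat.mem_divisors_self m hm)

/-- This turns F into the double series Σ z^{ab}/a. Summing over b first gives the Lambert series,
summing over a first gives the logarithms of Euler's product. -/
lemma coeff_F_eq_sum (m : ℕ+) :
    ((coeff m F : ℝ) : ℂ) = ∑ x ∈ (m : ℕ).divisorsAntidiagonal, 1 / (x.1 : ℂ) := by
  rw [coeff_F, ArithmeticFunction.sigma_one_apply,
    ← Nat.sum_divisorsAntidiagonal' (f := fun _ d => d)]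
  push_cast
  rw [Finset.sum_div]
  refine Finset.sum_congr rfl fun x hx => ?_
  obtain ⟨h, h0⟩ := Nat.mem_divisorsAntidiagonal.1 hx
  have h1 : (x.1 : ℂ) ≠ 0 := by
    intro h2; simp only [Nat.cast_eq_zero] at h2; simp [h2] at h; omega
  have h2 : (x.2 : ℂ) ≠ 0 := by
    intro h2; simp only [Nat.cast_eq_zero] at h2; simp [h2] at h; omega
  rw [← h]
  push_cast
  field_simp

lemma summable_pow_mul_div {z : ℂ} (hz : ‖z‖ < 1) :
    Summable fun c : ℕ+ × ℕ+ => z ^ (c.1 * c.2 : ℕ) / (c.1 : ℂ) := by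
  refine Summable.of_norm_bounded (summable_prod_mul_pow 0 hz).norm fun c => ?_
  have h1 : (1 : ℝ) ≤ (c.1 : ℕ) := Nat.one_le_cast.2 c.1.2
  simp only [pow_zero, one_mul, norm_div, Complex.norm_natCast]
  exact div_le_self (norm_nonneg _) h1

lemma hasSum_coeff_F {z : ℂ} (hz : ‖z‖ < 1) :
    HasSum (fun m : ℕ => ((coeff m F : ℝ) : ℂ) * z ^ m)
      (∑' c : ℕ+ × ℕ+, z ^ (c.1 * c.2 : ℕ) / (c.1 : ℂ)) := by
  have h1 := (summable_pow_mul_div hz).hasSum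
  rw [← sigmaAntidiagonalEquivProd.hasSum_iff] at h1
  have h2 := h1.sigma (g := fun n : ℕ+ => ((coeff n F : ℝ) : ℂ) * z ^ (n : ℕ)) (fun n => by
    rw [coeff_F_eq_sum, Finset.sum_mul, ← Finset.sum_coe_sort]
    convert hasSum_fintype _ using 2 with x
    have : ((divisorsAntidiagonalFactors n x).1 * (divisorsAntidiagonalFactors n x).2 : ℕ) = n :=
      divisorsAntidiagonalFactors_eq x
    change _ = z ^ ((divisorsAntidiagonalFactors n x).1 * (divisorsAntidiagonalFactors n x).2 : ℕ) /
      ((divisorsAntidiagonalFactors n x).1 : ℂ)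
    rw [this, one_div_mul_eq_div]
    rfl)
  have h3 : Function.Injective (fun n : ℕ+ => (n : ℕ)) := PNat.coe_injective
  refine (h3.hasSum_iff ?_).1 h2
  intro m hm
  have : m = 0 := by
    by_contra h
    exact hm ⟨⟨m, Nat.pos_of_ne_zero h⟩, rfl⟩
  simp [this, coeff_F]

lemma evalF_eq_tsum_prod {z : ℂ} (hz : ‖z‖ < 1) :
    evalF z = ∑' c : ℕ+ × ℕ+, z ^ (c.1 * c.2 : ℕ) / (c.1 : ℂ) := (hasSum_coeff_F hz).tsum_eq

lemma hasSum_evalF {z : ℂ} (hz : ‖z‖ < 1) :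
    HasSum (fun m : ℕ => ((coeff m F : ℝ) : ℂ) * z ^ m) (evalF z) := (hasSum_coeff_F hz).summable.hasSum

lemma summable_norm_coeff_F {z : ℂ} (hz : ‖z‖ < 1) :
    Summable fun m : ℕ => ‖((coeff m F : ℝ) : ℂ) * z ^ m‖ := (hasSum_coeff_F hz).summable.norm

/-- The Lambert series of `F`. -/
lemma hasSum_lambert {z : ℂ} (hz : ‖z‖ < 1) :
    HasSum (fun d : ℕ => (z ^ (d + 1) / (1 - z ^ (d + 1))) / ((d : ℂ) + 1)) (evalF z) := by
  have h1 := (summable_pow_mul_div hz).hasSum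
  rw [← evalF_eq_tsum_prod hz] at h1
  have h2 := h1.prod_fiberwise (g := fun d : ℕ+ =>
      (z ^ (d : ℕ) / (1 - z ^ (d : ℕ))) / (d : ℂ)) (fun d => by
    have hd : ‖z ^ (d : ℕ)‖ < 1 := by
      rw [norm_pow]; exact pow_lt_one₀ (norm_nonneg _) hz d.ne_zero
    have h3 := ((hasSum_geometric_of_norm_lt_one hd).mul_left (z ^ (d : ℕ))).div_const (d : ℂ)
    rw [← div_eq_mul_inv] at h3
    rw [← Equiv.pnatEquivNat.symm.hasSum_iff]
    convert h3 using 2 with e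
    · rfl
    simp only [Function.comp_apply, Equiv.pnatEquivNat_symm_apply, Nat.succPNat_coe,
      Nat.succ_eq_add_one]
    rw [← pow_mul, ← pow_add]
    ring_nf)
  rw [← Equiv.pnatEquivNat.symm.hasSum_iff] at h2
  convert h2 using 2 with d
  simp

/-- `F` as a sum of logarithms. -/
lemma hasSum_log {q : ℝ} (h0 : 0 ≤ q) (h1 : q < 1) :
    HasSum (fun j : ℕ => ((-Real.log (1 - q ^ (j + 1)) : ℝ) : ℂ)) (evalF q) := by
  have hz : ‖(q : ℂ)‖ < 1 := by rwa [Complex.norm_real, Real.norm_of_nonneg h0]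
  have h2 := (summable_pow_mul_div hz).hasSum
  rw [← evalF_eq_tsum_prod hz, ← (Equiv.prodComm _ _).hasSum_iff] at h2
  have h3 := h2.prod_fiberwise (g := fun d : ℕ+ =>
      ((-Real.log (1 - q ^ (d : ℕ)) : ℝ) : ℂ)) (fun d => by
    have hd : |q ^ (d : ℕ)| < 1 := by
      rw [abs_of_nonneg (by positivity)]; exact pow_lt_one₀ h0 h1 d.ne_zero
    have h4 := Complex.hasSum_ofReal.2 (Real.hasSum_pow_div_log_of_abs_lt_one hd)
    rw [← Equiv.pnatEquivNat.symm.hasSum_iff]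
    convert h4 using 2 with e
    simp [← pow_mul, mul_comm])
  rw [← Equiv.pnatEquivNat.symm.hasSum_iff] at h3
  convert h3 using 2 with d
  simp

lemma hasSum_coeff_F_pow {z : ℂ} (hz : ‖z‖ < 1) (k : ℕ) :
    (Summable fun m : ℕ => ‖((coeff m (F ^ k) : ℝ) : ℂ) * z ^ m‖) ∧
      ∑' m : ℕ, ((coeff m (F ^ k) : ℝ) : ℂ) * z ^ m = evalF z ^ k := by
  induction k with
  | zero =>
    have h : ∀ m : ℕ, ((coeff m ((1 : PowerSeries ℝ)) : ℝ) : ℂ) * z ^ m = if m = 0 then 1 else 0 := by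
      intro m
      rw [coeff_one]
      split_ifs with hm <;> simp [hm]
    simp only [pow_zero, h]
    constructor
    · refine summable_of_ne_finset_zero (s := {0}) fun m hm => ?_
      simp at hm
      simp [hm]
    · simp
  | succ k ih =>
    have key : ∀ m : ℕ, ((coeff m (F ^ (k + 1)) : ℝ) : ℂ) * z ^ m =
        ∑ x ∈ Finset.HasAntidiagonal.antidiagonal m, (((coeff x.1 (F ^ k) : ℝ) : ℂ) * z ^ x.1) *
          (((coeff x.2 F : ℝ) : ℂ) * z ^ x.2) := by
      intro m
      rw [pow_succ, coeff_mul]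
      push_cast
      rw [Finset.sum_mul]
      refine Finset.sum_congr rfl fun x hx => ?_
      rw [← Finset.HasAntidiagonal.mem_antidiagonal.1 hx, pow_add]
      ring
    simp only [key]
    have h1 := summable_norm_sum_mul_antidiagonal_of_summable_norm
      (f := fun m => ((coeff m (F ^ k) : ℝ) : ℂ) * z ^ m)
      (g := fun m => ((coeff m F : ℝ) : ℂ) * z ^ m) ih.1 (summable_norm_coeff_F hz)
    have h2 := tsum_mul_tsum_eq_tsum_sum_antidiagonal_of_summable_norm
      (f := fun m => ((coeff m (F ^ k) : ℝ) : ℂ) * z ^ m)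
      (g := fun m => ((coeff m F : ℝ) : ℂ) * z ^ m) ih.1 (summable_norm_coeff_F hz)
    refine ⟨h1, ?_⟩
    rw [ih.2] at h2
    rw [← h2, pow_succ, evalF]

open MeasureTheory in
/-- Cauchy's coefficient formula on the circle `|z| = exp (-r)`. -/
lemma integral_evalF_pow {r : ℝ} (hr : 0 < r) (n k : ℕ) :
    ∫ θ in (-Real.pi)..Real.pi,
      evalF (Complex.exp (-(r + θ * Complex.I))) ^ k * Complex.exp (n * (θ * Complex.I)) =
      2 * Real.pi * ((coeff n (F ^ k) : ℝ) : ℂ) * Complex.exp (-(n * r)) := by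
  have hz : ∀ θ : ℝ, ‖Complex.exp (-(r + θ * Complex.I))‖ < 1 := by
    intro θ
    rw [Complex.norm_exp]
    simpa using hr
  have hr' : ‖Complex.exp (-r)‖ < 1 := by
    rw [Complex.norm_exp]
    simpa using hr
  let f : ℕ → ℝ → ℂ := fun m θ => ((coeff m (F ^ k) : ℝ) : ℂ) * Complex.exp (-(r + θ * Complex.I)) ^ m *
    Complex.exp (n * (θ * Complex.I))
  have hf : ∀ m θ, f m θ = ((coeff m (F ^ k) : ℝ) : ℂ) * Complex.exp (-(m * r)) *
      Complex.exp ((n - m : ℂ) * Complex.I * θ) := by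
    intro m θ
    simp only [f]
    rw [← Complex.exp_nat_mul, mul_assoc, mul_assoc, ← Complex.exp_add, ← Complex.exp_add]
    ring_nf
  have hint : ∀ m, ∫ θ in (-Real.pi)..Real.pi, f m θ =
      if m = n then 2 * Real.pi * ((coeff n (F ^ k) : ℝ) : ℂ) * Complex.exp (-(n * r)) else 0 := by
    intro m
    simp only [hf]
    rw [intervalIntegral.integral_const_mul]
    split_ifs with h
    · subst h
      simp
      ring
    · have hne : (n - m : ℂ) * Complex.I ≠ 0 := by
        refine mul_ne_zero (sub_ne_zero.2 ?_) Complex.I_ne_zero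
        exact_mod_cast Ne.symm h
      rw [integral_exp_mul_complex hne]
      have : Complex.exp ((n - m : ℂ) * Complex.I * (Real.pi : ℝ)) =
          Complex.exp ((n - m : ℂ) * Complex.I * ((-Real.pi : ℝ) : ℂ)) := by
        rw [Complex.exp_eq_exp_iff_exists_int]
        refine ⟨(n : ℤ) - m, ?_⟩
        push_cast
        ring
      rw [this]
      simp
  -- Sum and integral may be exchanged, because the norm of each summand does not depend on θ and is
  -- summable at θ = 0.
  have hsum := intervalIntegral.hasSum_intervalIntegral_of_summable_norm (a := -Real.pi) (b := Real.pi)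
    (f := fun m => ⟨f m, by fun_prop⟩) (E := ℂ) (by
      refine Summable.of_nonneg_of_le (fun m => norm_nonneg _) (fun m => ?_)
        (hasSum_coeff_F_pow hr' k).1
      rw [ContinuousMap.norm_le _ (norm_nonneg _)]
      intro θ
      simp only [ContinuousMap.restrict_apply, ContinuousMap.coe_mk]
      simp only [f, norm_mul, norm_pow, Complex.norm_exp]
      simp)
  simp only [ContinuousMap.coe_mk] at hsum
  have h1 : ∀ θ : ℝ, ∑' m, f m θ =
      evalF (Complex.exp (-(r + θ * Complex.I))) ^ k * Complex.exp (n * (θ * Complex.I)) := by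
    intro θ
    simp only [f]
    rw [tsum_mul_right, (hasSum_coeff_F_pow (hz θ) k).2]
  simp only [h1, hint] at hsum
  exact hsum.unique (hasSum_ite_eq n _)

/-! ### Behaviour of F near 1 through the eta function. -/

/-- The value of `F` at `exp (-r)`. -/
noncomputable def Fr (r : ℝ) : ℝ := ∑' j : ℕ, -Real.log (1 - Real.exp (-r) ^ (j + 1))

lemma evalF_exp_neg {r : ℝ} (hr : 0 < r) : evalF (Complex.exp (-r)) = Fr r := by
  have h := hasSum_log (q := Real.exp (-r)) (Real.exp_pos _).le (by simpa using hr)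
  rw [Fr, Complex.ofReal_tsum, h.tsum_eq]
  simp

lemma eta_I_mul {r : ℝ} (hr : 0 < r) :
    ModularForm.eta (Complex.I * (r / (2 * Real.pi) : ℝ)) = Complex.exp (-(r / 24) - Fr r) := by
  have hpi : (Real.pi : ℂ) ≠ 0 := by exact_mod_cast Real.pi_ne_zero
  have hq : ∀ n, ModularForm.eta_q n (Complex.I * (r / (2 * Real.pi) : ℝ)) =
      ((Real.exp (-r) ^ (n + 1) : ℝ) : ℂ) := by
    intro n
    rw [ModularForm.eta_q_eq_pow]
    push_cast
    congr 2
    field_simp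
    rw [Complex.I_sq]
    ring
  have h := hasSum_log (q := Real.exp (-r)) (Real.exp_pos _).le (by simpa using hr)
  have hprod : HasProd (fun n : ℕ => 1 - ((Real.exp (-r) ^ (n + 1) : ℝ) : ℂ))
      (Complex.exp (-Fr r)) := by
    have h2 := h.neg.cexp
    rw [show ((Real.exp (-r) : ℝ) : ℂ) = Complex.exp (-r) by push_cast; rfl,
      evalF_exp_neg hr] at h2
    convert h2 using 2 with n
    have hlt : Real.exp (-r) ^ (n + 1) < 1 :=
      pow_lt_one₀ (Real.exp_pos _).le (by simpa using hr) (by omega)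
    simp only [Function.comp_apply, Complex.ofReal_neg, neg_neg]
    rw [← Complex.ofReal_exp, Real.exp_log (by linarith)]
    push_cast
    rfl
  rw [ModularForm.eta]
  simp only [hq]
  rw [hprod.tprod_eq, Function.Periodic.qParam, ← Complex.exp_add]
  congr 1
  push_cast
  field_simp
  rw [Complex.I_sq]
  ring

/-- The transformation formula of the Dedekind eta function on the imaginary axis. -/
lemma Fr_eq {r : ℝ} (hr : 0 < r) : Fr r =
    Real.pi ^ 2 / (6 * r) + 1 / 2 * Real.log (r / (2 * Real.pi)) - r / 24
      + Fr (4 * Real.pi ^ 2 / r) := by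
  have hpi := Real.pi_pos
  have hz : Complex.I * (r / (2 * Real.pi) : ℝ) ∈ UpperHalfPlane.upperHalfPlaneSet := by
    simp only [UpperHalfPlane.upperHalfPlaneSet, Set.mem_ofPred_eq, Complex.I_mul_im, Complex.ofReal_re]
    positivity
  have h := ModularForm.eta_comp_eq_csqrt_I_inv hz
  simp only [Function.comp_apply, Pi.smul_apply, Pi.mul_apply, smul_eq_mul] at h
  have hpi' : (Real.pi : ℂ) ≠ 0 := by exact_mod_cast Real.pi_ne_zero
  have hr' : (r : ℂ) ≠ 0 := by exact_mod_cast hr.ne'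
  -- At τ = ir/(2π) the nome is e^{-r}, and τ ↦ -1/τ becomes r ↦ 4π²/r.
  have hinv : -1 / (Complex.I * (r / (2 * Real.pi) : ℝ)) =
      Complex.I * ((4 * Real.pi ^ 2 / r) / (2 * Real.pi) : ℝ) := by
    push_cast
    field_simp
    rw [Complex.I_sq]
    ring
  have hsq : ∀ z : ℂ, z ≠ 0 → ‖Complex.sqrt z‖ ^ 2 = ‖z‖ := by
    intro z hz
    rw [← norm_pow, sqrt_eq_exp hz, ← Complex.exp_nat_mul]
    congr 1
    rw [show ((2 : ℕ) : ℂ) * (Complex.log z / 2) = Complex.log z by push_cast; ring,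
      Complex.exp_log hz]
  rw [hinv, eta_I_mul hr, eta_I_mul (by positivity)] at h
  -- Squared moduli suffice, since both exponents are real; this removes the complex square roots
  -- and their branches.
  have h2 := congrArg (fun z => ‖z‖ ^ 2) h
  simp only [norm_mul, norm_inv, mul_pow, inv_pow] at h2
  rw [hsq _ Complex.I_ne_zero, hsq _ (mul_ne_zero Complex.I_ne_zero
    (by exact_mod_cast (by positivity : r / (2 * Real.pi) ≠ 0))), norm_mul, Complex.norm_I,
    Complex.norm_real, Real.norm_of_nonneg (by positivity), Complex.norm_exp, Complex.norm_exp,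
    ← Real.exp_nat_mul, ← Real.exp_nat_mul] at h2
  have h3 := congrArg Real.log h2
  rw [inv_one, one_mul, one_mul, Real.log_mul (by positivity) (Real.exp_ne_zero _), Real.log_exp,
    Real.log_exp] at h3
  simp only [Complex.sub_re, Complex.neg_re, Complex.ofReal_re] at h3
  have e1 : ((r : ℂ) / 24).re = r / 24 := by
    rw [show (r : ℂ) / 24 = ((r / 24 : ℝ) : ℂ) by push_cast; rfl, Complex.ofReal_re]
  have e2 : (((4 * Real.pi ^ 2 / r : ℝ) : ℂ) / 24).re = Real.pi ^ 2 / (6 * r) := by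
    rw [show ((4 * Real.pi ^ 2 / r : ℝ) : ℂ) / 24 = ((4 * Real.pi ^ 2 / r / 24 : ℝ) : ℂ) by
      push_cast; rfl, Complex.ofReal_re]
    field_simp
    ring
  rw [e1, e2] at h3
  push_cast at h3
  linarith

lemma tendsto_evalF_zero : Tendsto evalF (𝓝 0) (𝓝 0) := by
  have hs : Summable fun m : ℕ => coeff m F * (1 / 2 : ℝ) ^ m := by
    have := summable_norm_coeff_F (z := 1 / 2) (by norm_num)
    refine this.congr fun m => ?_
    simp [abs_of_nonneg (coeff_F_nonneg m)]
  have h := tendsto_tsum_of_dominated_convergence (𝓕 := 𝓝 (0 : ℂ))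
    (f := fun z m => ((coeff m F : ℝ) : ℂ) * z ^ m) (g := fun _ => 0) hs (by
      intro m
      rcases m with _ | m
      · simp [F]
      · have : Continuous fun z : ℂ => ((coeff (m + 1) F : ℝ) : ℂ) * z ^ (m + 1) := by fun_prop
        simpa using this.tendsto 0) (by
      filter_upwards [Metric.ball_mem_nhds (0 : ℂ) (by norm_num : (0 : ℝ) < 1 / 2)] with z hz m
      rw [mem_ball_zero_iff] at hz
      simp only [norm_mul, norm_pow, Complex.norm_real, Real.norm_of_nonneg (coeff_F_nonneg m)]
      exact mul_le_mul_of_nonneg_left (pow_le_pow_left₀ (norm_nonneg _) hz.le _) (coeff_F_nonneg m))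
  rw [tsum_zero] at h
  exact h

lemma tendsto_Fr_atTop : Tendsto Fr atTop (𝓝 0) := by
  have h1 : Tendsto (fun r : ℝ => Complex.exp (-r)) atTop (𝓝 0) := by
    have := (Complex.continuous_ofReal.tendsto 0).comp
      (Real.tendsto_exp_atBot.comp tendsto_neg_atTop_atBot)
    refine Tendsto.congr (fun r => ?_) this
    simp
  have h2 := (Complex.continuous_re.tendsto 0).comp (tendsto_evalF_zero.comp h1)
  refine h2.congr' ?_
  filter_upwards [eventually_gt_atTop 0] with r hr
  simp [evalF_exp_neg hr]

/-- After the transformation the remainder is `Fr` at an argument tending to infinity, minus r/24;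
both vanish in the limit. -/
lemma tendsto_Fr_sub : Tendsto (fun r => Fr r -
    (Real.pi ^ 2 / (6 * r) + 1 / 2 * Real.log (r / (2 * Real.pi)))) (𝓝[>] 0) (𝓝 0) := by
  have h1 : Tendsto (fun r : ℝ => Fr (4 * Real.pi ^ 2 / r)) (𝓝[>] 0) (𝓝 0) := by
    refine tendsto_Fr_atTop.comp ?_
    exact (tendsto_inv_nhdsGT_zero.const_mul_atTop (by positivity)).congr
      fun r => (div_eq_mul_inv _ _).symm
  have h2 : Tendsto (fun r : ℝ => r / 24) (𝓝[>] 0) (𝓝 0) := by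
    have : Continuous fun r : ℝ => r / 24 := by fun_prop
    simpa using (this.tendsto 0).mono_left nhdsWithin_le_nhds
  have h3 := h1.sub h2
  rw [sub_zero] at h3
  refine h3.congr' ?_
  filter_upwards [self_mem_nhdsWithin] with r hr
  rw [Fr_eq hr]
  ring

lemma eventually_Fr_le : ∀ᶠ r in 𝓝[>] (0 : ℝ), Fr r ≤ 3 / r := by
  filter_upwards [tendsto_Fr_sub.eventually_le_const (show (0 : ℝ) < 1 by norm_num),
    self_mem_nhdsWithin, Ioo_mem_nhdsGT (show (0 : ℝ) < 1 by norm_num)] with r h hr hr1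
  have hr0 : 0 < r := hr
  have hpi := Real.pi_gt_three
  have hlog : Real.log (r / (2 * Real.pi)) ≤ 0 := by
    apply Real.log_nonpos (by positivity)
    rw [div_le_one (by positivity)]
    linarith [hr1.2]
  have h1 : Real.pi ^ 2 / (6 * r) ≤ 2 / r := by
    rw [div_le_div_iff₀ (by positivity) hr0]
    have : Real.pi ^ 2 ≤ 12 := by nlinarith [Real.pi_lt_d2]
    nlinarith
  have h2 : 1 ≤ 1 / r := by
    rw [le_div_iff₀ hr0]
    linarith [hr1.2]
  have h3 : 3 / r = 2 / r + 1 / r := by ring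
  linarith

/-! ### Decay of |F| away from the positive axis. -/

lemma exists_norm_eq_one_mul_eq_norm (w : ℂ) : ∃ u : ℂ, ‖u‖ = 1 ∧ u * w = ‖w‖ := by
  by_cases hw : w = 0
  · exact ⟨1, by simp, by simp [hw]⟩
  · have hn : (‖w‖ : ℂ) ≠ 0 := by simpa using hw
    refine ⟨starRingEnd ℂ w / ‖w‖, by simp [hw], ?_⟩
    rw [div_mul_eq_mul_div, mul_comm, Complex.mul_conj, Complex.normSq_eq_norm_sq]
    push_cast
    field_simp

/-- The coefficients of `F` dominate those of the geometric series. -/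
lemma geometric_sub_le {z : ℂ} (hz : ‖z‖ < 1) :
    ‖z‖ / (1 - ‖z‖) - ‖z / (1 - z)‖ ≤ (evalF ‖z‖).re - ‖evalF z‖ := by
  -- Rotating the value onto the positive axis writes the deficit as a series with nonnegative
  -- terms, which can be compared term by term because σ(m)/m ≥ 1.
  obtain ⟨u, hu, huw⟩ := exists_norm_eq_one_mul_eq_norm (evalF z)
  have hz' : ‖((‖z‖ : ℝ) : ℂ)‖ < 1 := by simpa using hz
  have h1 : HasSum (fun m : ℕ => coeff m F * (‖z‖ ^ m - (u * z ^ m).re))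
      ((evalF ‖z‖).re - ‖evalF z‖) := by
    have h2 := Complex.hasSum_re (hasSum_evalF hz')
    have h3 := Complex.hasSum_re ((hasSum_evalF hz).mul_left u)
    rw [huw, Complex.ofReal_re] at h3
    convert h2.sub h3 using 2 with m
    · rfl
    rw [← Complex.ofReal_pow, ← Complex.ofReal_mul, Complex.ofReal_re,
      mul_left_comm, Complex.re_ofReal_mul]
    ring
  have h4 : HasSum (fun m : ℕ => (if m = 0 then 0 else 1) * (‖z‖ ^ m - (u * z ^ m).re))
      (‖z‖ / (1 - ‖z‖) - (u * (z / (1 - z))).re) := by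
    rw [← hasSum_nat_add_iff' 1]
    simp only [Finset.range_one, Finset.sum_singleton, if_true, zero_mul, sub_zero]
    have h5 := (hasSum_geometric_of_norm_lt_one
      (show ‖(‖z‖ : ℝ)‖ < 1 by simpa using hz)).mul_left ‖z‖
    have h6 := Complex.hasSum_re (((hasSum_geometric_of_norm_lt_one hz).mul_left z).mul_left u)
    rw [div_eq_mul_inv, div_eq_mul_inv]
    convert h5.sub h6 using 2 with m
    simp [pow_succ']
  have h7 : ∀ m : ℕ, 0 ≤ ‖z‖ ^ m - (u * z ^ m).re := by
    intro m
    have := Complex.re_le_norm (u * z ^ m)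
    rw [norm_mul, hu, one_mul, norm_pow] at this
    linarith
  have h8 := hasSum_le (fun m => ?_) h4 h1
  · have := Complex.re_le_norm (u * (z / (1 - z)))
    rw [norm_mul, hu, one_mul] at this
    linarith
  · split_ifs with hm
    · rw [zero_mul]
      exact mul_nonneg (coeff_F_nonneg m) (h7 m)
    · exact mul_le_mul_of_nonneg_right (one_le_coeff_F hm) (h7 m)

/-- It rests on |1 - z|² = (1 - ρ)² + 2ρ(1 - cos θ), with ρ = |z| and 1 - ρ ≤ r: once |θ| is of
order r, the second term is comparable with the first. -/
lemma geometric_sub_ge {r θ : ℝ} (hr : 0 < r) (hr1 : r ≤ 1) (hθ : |θ| ≤ Real.pi) :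
    1 / (96 * r) * min ((θ / r) ^ 2) 1 ≤ Real.exp (-r) / (1 - Real.exp (-r)) -
      ‖Complex.exp (-(r + θ * Complex.I)) / (1 - Complex.exp (-(r + θ * Complex.I)))‖ := by
  set ρ := Real.exp (-r) with hρ
  -- The factor 1/8 works because 1/8 ≤ 2 · (1/3) · (1/5), from ρ ≥ 1/3 and 1 - cos θ ≥ θ²/5. The
  -- final constant is 96 = 3 · 4 · 8.
  set s := min ((θ / r) ^ 2) 1 / 8 with hs
  have hs0 : 0 ≤ s := by positivity
  have hs1 : s ≤ 1 / 8 := by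
    have := min_le_right ((θ / r) ^ 2) 1
    rw [hs]; linarith
  have hsθ : 8 * s * r ^ 2 ≤ θ ^ 2 := by
    have := min_le_left ((θ / r) ^ 2) 1
    rw [div_pow, le_div_iff₀ (by positivity)] at this
    rw [hs]; simp only [div_pow]; linarith
  have hρ1 : 1 - ρ ≤ r := by linarith [Real.add_one_le_exp (-r)]
  have hρlt : ρ < 1 := by simpa [hρ] using hr
  have hρ3 : 1 / 3 ≤ ρ := by
    have h1 : Real.exp (-1) ≤ ρ := Real.exp_le_exp.2 (by linarith)
    have h2 : (1 : ℝ) / 3 ≤ Real.exp (-1) := by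
      rw [Real.exp_neg, one_div]
      exact inv_anti₀ (Real.exp_pos _) (by linarith [Real.exp_one_lt_d9])
    linarith
  have hnorm : ‖Complex.exp (-(r + θ * Complex.I))‖ = ρ := by
    rw [Complex.norm_exp]; simp [hρ]
  have hsq : ‖1 - Complex.exp (-(r + θ * Complex.I))‖ ^ 2 =
      (1 - ρ) ^ 2 + 2 * ρ * (1 - Real.cos θ) := by
    rw [← Complex.normSq_eq_norm_sq, Complex.normSq_apply]
    simp only [Complex.sub_re, Complex.one_re, Complex.exp_re, Complex.neg_re, Complex.add_re,
      Complex.ofReal_re, Complex.mul_re, Complex.I_re, mul_zero, Complex.ofReal_im, Complex.I_im,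
      sub_zero, add_zero, Complex.neg_im, Complex.add_im, Complex.mul_im, mul_one,
      zero_add, Real.cos_neg, Complex.sub_im, Complex.one_im, Complex.exp_im, Real.sin_neg]
    rw [← hρ]
    linear_combination ρ ^ 2 * Real.sin_sq_add_cos_sq θ
  have hcos := Real.cos_le_one_sub_mul_cos_sq hθ
  have hpi : 2 / Real.pi ^ 2 ≥ 1 / 5 := by
    rw [ge_iff_le, div_le_div_iff₀ (by norm_num) (by positivity)]
    nlinarith [Real.pi_lt_d2, Real.pi_gt_three]
  have hlow : (1 - ρ) * (1 + s / 3) ≤ ‖1 - Complex.exp (-(r + θ * Complex.I))‖ := by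
    refine le_of_sq_le_sq ?_ (norm_nonneg _)
    rw [hsq]
    have h1 : 1 / 5 * θ ^ 2 ≤ 1 - Real.cos θ := by nlinarith [sq_nonneg θ]
    have h2 : (1 - ρ) ^ 2 ≤ r ^ 2 := by nlinarith
    have h3 : (1 - ρ) ^ 2 * s ≤ 2 * ρ * (1 - Real.cos θ) := by
      calc (1 - ρ) ^ 2 * s ≤ r ^ 2 * s := by gcongr
        _ ≤ θ ^ 2 / 8 := by linarith
        _ ≤ 2 * (1 / 3) * (1 / 5 * θ ^ 2) := by nlinarith [sq_nonneg θ]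
        _ ≤ 2 * ρ * (1 - Real.cos θ) := by gcongr
    have h4 : (1 + s / 3) ^ 2 ≤ 1 + s := by nlinarith
    calc ((1 - ρ) * (1 + s / 3)) ^ 2 = (1 - ρ) ^ 2 * (1 + s / 3) ^ 2 := by ring
      _ ≤ (1 - ρ) ^ 2 * (1 + s) := by gcongr
      _ ≤ _ := by linarith
  rw [norm_div, hnorm]
  have ha : 0 < 1 - ρ := by linarith
  have h5 : ρ / ‖1 - Complex.exp (-(r + θ * Complex.I))‖ ≤ ρ / (1 - ρ) * (1 - s / 4) := by
    calc _ ≤ ρ / ((1 - ρ) * (1 + s / 3)) := by gcongr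
      _ = ρ / (1 - ρ) * (1 / (1 + s / 3)) := by field_simp
      _ ≤ _ := by
        gcongr
        rw [div_le_iff₀ (by positivity)]
        nlinarith
  have h6 : 1 / (3 * r) ≤ ρ / (1 - ρ) := by
    rw [div_le_div_iff₀ (by positivity) ha]
    nlinarith
  have h7 : min ((θ / r) ^ 2) 1 = 8 * s := by rw [hs]; ring
  rw [h7]
  calc 1 / (96 * r) * (8 * s) = 1 / (3 * r) * (s / 4) := by field_simp; ring
    _ ≤ ρ / (1 - ρ) * (s / 4) := by gcongr
    _ ≤ _ := by linarith

/-- Away from the positive axis, `F` is smaller by a definite factor. -/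
lemma eventually_norm_evalF_le : ∀ᶠ r : ℝ in 𝓝[>] 0, ∀ θ : ℝ, |θ| ≤ Real.pi →
    ‖evalF (Complex.exp (-(r + θ * Complex.I)))‖ ≤ (1 - min ((θ / r) ^ 2) 1 / 288) * Fr r := by
  filter_upwards [eventually_Fr_le, self_mem_nhdsWithin,
    Ioo_mem_nhdsGT (show (0 : ℝ) < 1 by norm_num)] with r h hr hr1 θ hθ
  have hr0 : 0 < r := hr
  have hnorm : ‖Complex.exp (-(r + θ * Complex.I))‖ = Real.exp (-r) := by
    rw [Complex.norm_exp]; simp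
  have h1 := geometric_sub_le (z := Complex.exp (-(r + θ * Complex.I))) (by
    rw [hnorm]; simpa using hr0)
  have h2 := geometric_sub_ge hr0 hr1.2.le hθ
  rw [hnorm, show ((Real.exp (-r) : ℝ) : ℂ) = Complex.exp (-r) by push_cast; rfl,
    evalF_exp_neg hr0, Complex.ofReal_re] at h1
  -- The bound `Fr r ≤ 3 / r` makes the absolute gain a relative one: 288 = 3 · 96.
  have h3 : min ((θ / r) ^ 2) 1 / 288 * Fr r ≤ min ((θ / r) ^ 2) 1 / 288 * (3 / r) := by
    gcongr
  have h4 : min ((θ / r) ^ 2) 1 / 288 * (3 / r) = 1 / (96 * r) * min ((θ / r) ^ 2) 1 := by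
    generalize min ((θ / r) ^ 2) 1 = w
    field_simp
    ring
  linarith

/-! ### Slow variation of t F(e^{-t}). -/

lemma norm_exp_I_mul_sub_le (y : ℝ) :
    ‖Complex.exp (y * Complex.I) - 1 - y * Complex.I‖ ≤ 2 * y ^ 2 := by
  by_cases hy : |y| ≤ 1
  · have := Complex.norm_exp_sub_one_sub_id_le (x := y * Complex.I) (by simpa using hy)
    simp only [norm_mul, Complex.norm_real, Complex.norm_I, mul_one, Real.norm_eq_abs, sq_abs] at this
    nlinarith [sq_nonneg y]
  · push Not at hy
    have h1 : ‖Complex.exp (y * Complex.I) - 1‖ ≤ |y| := by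
      have := Real.norm_exp_I_mul_ofReal_sub_one_le (x := y)
      rwa [mul_comm, Real.norm_eq_abs] at this
    have h2 := norm_sub_le (Complex.exp (y * Complex.I) - 1) (y * Complex.I)
    simp only [norm_mul, Complex.norm_real, Complex.norm_I, mul_one, Real.norm_eq_abs] at h2
    nlinarith [sq_abs y]

/-- The left side is bounded near 0 and decays at infinity. A power x^{-a} with 0 < a < 1/2 is what
the sequel needs: a > 0 makes the sum over dilates converge, a < 1/2 makes the error vanish in
`tendsto_sqrt_mul_rpow`. -/
lemma sq_mul_exp_div_le {x : ℝ} (hx : 0 < x) :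
    x ^ 2 * Real.exp x / (Real.exp x - 1) ^ 2 ≤ 24 * x ^ (-(1 / 4) : ℝ) := by
  have h1 : x < Real.exp x - 1 := by linarith [Real.add_one_lt_exp hx.ne']
  rcases le_total x 1 with hx1 | hx1
  · have h2 : Real.exp x ≤ 3 := by
      have := Real.exp_le_exp.2 hx1
      linarith [Real.exp_one_lt_d9]
    have h3 : (1 : ℝ) ≤ x ^ (-(1 / 4) : ℝ) :=
      Real.one_le_rpow_of_pos_of_le_one_of_nonpos hx hx1 (by norm_num)
    calc x ^ 2 * Real.exp x / (Real.exp x - 1) ^ 2 ≤ x ^ 2 * 3 / x ^ 2 := by gcongr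
      _ = 3 := by field_simp
      _ ≤ _ := by linarith
  · have h2 : Real.exp x / 2 ≤ Real.exp x - 1 := by linarith [Real.add_one_le_exp x]
    have h3 : x ^ 3 / 6 ≤ Real.exp x := by
      have := Real.pow_div_factorial_le_exp x hx.le 3
      norm_num [Nat.factorial] at this
      linarith
    have h4 : x ^ (-1 : ℝ) ≤ x ^ (-(1 / 4) : ℝ) :=
      Real.rpow_le_rpow_of_exponent_le hx1 (by norm_num)
    rw [Real.rpow_neg_one] at h4
    have he := Real.exp_pos x
    calc x ^ 2 * Real.exp x / (Real.exp x - 1) ^ 2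
        ≤ x ^ 2 * Real.exp x / (Real.exp x / 2) ^ 2 := by gcongr
      _ = 4 * x ^ 2 / Real.exp x := by field_simp; norm_num
      _ ≤ 4 * x ^ 2 / (x ^ 3 / 6) := by gcongr
      _ = 24 * x⁻¹ := by field_simp; norm_num
      _ ≤ _ := by gcongr

lemma exp_sub_one_le_norm (x y : ℝ) :
    Real.exp x - 1 ≤ ‖Complex.exp (x + y * Complex.I) - 1‖ := by
  have := norm_sub_norm_le (Complex.exp (x + y * Complex.I)) 1
  rw [Complex.norm_exp] at this
  simpa using this

/-- The function `z / (exp z - 1)` varies slowly in the imaginary direction. -/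
lemma norm_div_exp_sub_one_sub_le {x y : ℝ} (hx : 0 < x) (hy : |y| ≤ x) :
    ‖((x + y * Complex.I) / (Complex.exp (x + y * Complex.I) - 1) -
      x / (Complex.exp x - 1) : ℂ)‖ ≤ 72 * |y| * x ^ (-(1 / 4) : ℝ) := by
  have h1 : x < Real.exp x - 1 := by linarith [Real.add_one_lt_exp hx.ne']
  have h2 := exp_sub_one_le_norm x y
  have hx0 : ‖Complex.exp x - 1‖ = Real.exp x - 1 := by
    rw [← Complex.ofReal_exp, ← Complex.ofReal_one, ← Complex.ofReal_sub, Complex.norm_real,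
      Real.norm_of_nonneg (by linarith)]
  have hne1 : Complex.exp (x + y * Complex.I) - 1 ≠ 0 := by
    rw [← norm_pos_iff]; linarith
  have hne2 : Complex.exp x - 1 ≠ 0 := by
    rw [← norm_pos_iff]; linarith
  -- Terms are grouped by subtracting the linear part in y, so that each of the two products is
  -- O(|y| x² e^x).
  have hN : ((x + y * Complex.I) / (Complex.exp (x + y * Complex.I) - 1) -
      x / (Complex.exp x - 1) : ℂ) =
      (y * Complex.I * ((Real.exp x - 1 - x * Real.exp x : ℝ) : ℂ) -
        ((x * Real.exp x : ℝ) : ℂ) * (Complex.exp (y * Complex.I) - 1 - y * Complex.I)) /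
        ((Complex.exp (x + y * Complex.I) - 1) * (Complex.exp x - 1)) := by
    rw [div_sub_div _ _ hne1 hne2]
    congr 1
    rw [Complex.exp_add]
    push_cast
    ring
  have h3 : |Real.exp x - 1 - x * Real.exp x| ≤ x ^ 2 * Real.exp x := by
    have he := Real.exp_pos x
    have h4 : 1 - x ≤ Real.exp (-x) := by linarith [Real.add_one_le_exp (-x)]
    have h5 : Real.exp (-x) * (1 + x) ≤ 1 := by
      have := Real.add_one_le_exp x
      calc Real.exp (-x) * (1 + x) ≤ Real.exp (-x) * Real.exp x := by gcongr; linarith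
        _ = 1 := by rw [← Real.exp_add]; simp
    have h6 : Real.exp (-x) * Real.exp x = 1 := by rw [← Real.exp_add]; simp
    have h7 : Real.exp (-x) ≤ 1 - x + x ^ 2 := by
      have h8 : Real.exp (-x) * (1 + x) ≤ (1 - x + x ^ 2) * (1 + x) := by
        nlinarith [pow_pos hx 3]
      exact le_of_mul_le_mul_right h8 (by linarith)
    rw [abs_le]
    constructor <;> nlinarith
  have h4 : ‖(y * Complex.I * ((Real.exp x - 1 - x * Real.exp x : ℝ) : ℂ) -
        ((x * Real.exp x : ℝ) : ℂ) * (Complex.exp (y * Complex.I) - 1 - y * Complex.I))‖ ≤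
        3 * |y| * (x ^ 2 * Real.exp x) := by
    refine (norm_sub_le _ _).trans ?_
    simp only [norm_mul, Complex.norm_real, Complex.norm_I, mul_one, Real.norm_eq_abs]
    rw [abs_of_pos hx, abs_of_pos (Real.exp_pos x)]
    have h5 := norm_exp_I_mul_sub_le y
    have h6 : y ^ 2 ≤ |y| * x := by
      rw [← sq_abs, sq]; gcongr
    calc |y| * |Real.exp x - 1 - x * Real.exp x| + x * Real.exp x *
          ‖Complex.exp (y * Complex.I) - 1 - y * Complex.I‖
        ≤ |y| * (x ^ 2 * Real.exp x) + x * Real.exp x * (2 * (|y| * x)) := by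
          gcongr
          linarith
      _ = _ := by ring
  rw [hN, norm_div, norm_mul, hx0]
  calc _ ≤ 3 * |y| * (x ^ 2 * Real.exp x) / ((Real.exp x - 1) * (Real.exp x - 1)) := by
        have h0 : 0 < Real.exp x - 1 := by linarith
        exact div_le_div₀ (by positivity) h4 (mul_pos h0 h0) (by gcongr)
    _ = 3 * |y| * (x ^ 2 * Real.exp x / (Real.exp x - 1) ^ 2) := by ring
    _ ≤ 3 * |y| * (24 * x ^ (-(1 / 4) : ℝ)) := by gcongr; exact sq_mul_exp_div_le hx
    _ = _ := by ring

/-- The Lambert series, multiplied by t, superposes the dilates of z/(e^z - 1) with weights 1/d². -/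
lemma hasSum_mul_evalF {t : ℂ} (ht : 0 < t.re) :
    HasSum (fun d : ℕ => (((d + 1 : ℝ) : ℂ) * t / (Complex.exp (((d + 1 : ℝ) : ℂ) * t) - 1)) /
      ((d + 1 : ℝ) : ℂ) ^ 2) (t * evalF (Complex.exp (-t))) := by
  have hz : ‖Complex.exp (-t)‖ < 1 := by
    rw [Complex.norm_exp]; simpa using ht
  refine ((hasSum_lambert hz).mul_left t).congr_fun ?_
  intro d
  have hd : ((d : ℂ) + 1) ≠ 0 := by exact_mod_cast d.succ_ne_zero
  have h1 : Complex.exp (-t) ^ (d + 1) = (Complex.exp (((d : ℂ) + 1) * t))⁻¹ := by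
    rw [← Complex.exp_nat_mul, ← Complex.exp_neg]
    push_cast
    ring_nf
  have h2 : Complex.exp (((d : ℂ) + 1) * t) ≠ 0 := Complex.exp_ne_zero _
  have h3 : Complex.exp (((d : ℂ) + 1) * t) - 1 ≠ 0 := by
    have := exp_sub_one_le_norm ((d + 1 : ℝ) * t.re) ((d + 1 : ℝ) * t.im)
    rw [← norm_pos_iff]
    have h4 : (((d + 1 : ℝ) * t.re : ℝ) : ℂ) + ((d + 1 : ℝ) * t.im : ℝ) * Complex.I =
        ((d : ℂ) + 1) * t := by
      apply Complex.ext <;> simp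
    rw [h4] at this
    have h5 : 1 < Real.exp ((d + 1 : ℝ) * t.re) := by
      rw [Real.one_lt_exp_iff]; positivity
    linarith
  push_cast
  rw [h1]
  have h6 : 1 - (Complex.exp (((d : ℂ) + 1) * t))⁻¹ ≠ 0 := by
    rw [sub_ne_zero]
    intro h
    apply h3
    rw [← inv_inj, inv_one] at h
    rw [inv_inv] at h
    rw [← h, sub_self]
  field_simp

/-- A mere Lipschitz bound on z/(e^z - 1) would leave the divergent Σ 1/d; the extra factor x^{-1/4}
turns it into Σ d^{-5/4}. -/
lemma exists_norm_mul_evalF_sub_le : ∃ C : ℝ, 0 ≤ C ∧ ∀ r θ : ℝ, 0 < r → |θ| ≤ r →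
    ‖(r + θ * Complex.I) * evalF (Complex.exp (-(r + θ * Complex.I))) - r * Fr r‖ ≤
      C * (|θ| * r ^ (-(1 / 4) : ℝ)) := by
  have hs : Summable fun d : ℕ => ((d : ℝ) + 1) ^ (-(5 / 4) : ℝ) := by
    have := (summable_nat_add_iff 1).2 (Real.summable_nat_rpow (p := (-(5 / 4) : ℝ)).2 (by norm_num))
    simpa using this
  refine ⟨72 * ∑' d : ℕ, ((d : ℝ) + 1) ^ (-(5 / 4) : ℝ), by positivity, ?_⟩
  intro r θ hr hθ
  have h1 := hasSum_mul_evalF (t := r + θ * Complex.I) (by simpa using hr)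
  have h2 := hasSum_mul_evalF (t := r) (by simpa using hr)
  rw [evalF_exp_neg hr] at h2
  have h3 := h1.sub h2
  rw [← h3.tsum_eq]
  have h4 := (hs.mul_left (72 * (|θ| * r ^ (-(1 / 4) : ℝ)))).hasSum
  rw [tsum_mul_left] at h4
  refine (tsum_of_norm_bounded h4 fun d => ?_).trans (le_of_eq (by ring))
  have hd : (0 : ℝ) < (d : ℝ) + 1 := by positivity
  have h5 := norm_div_exp_sub_one_sub_le (x := (d + 1) * r) (y := (d + 1) * θ) (by positivity) (by
    rw [abs_mul, abs_of_pos hd]; gcongr)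
  rw [← sub_div, norm_div, norm_pow, Complex.norm_real, Real.norm_of_nonneg hd.le,
    div_le_iff₀ (by positivity)]
  have e1 : ((((d : ℝ) + 1) * r : ℝ) : ℂ) + (((d : ℝ) + 1) * θ : ℝ) * Complex.I =
      (((d : ℝ) + 1 : ℝ) : ℂ) * (r + θ * Complex.I) := by push_cast; ring
  rw [e1, Complex.ofReal_mul ((d : ℝ) + 1) r] at h5
  refine h5.trans (le_of_eq ?_)
  rw [abs_mul, abs_of_pos hd, Real.mul_rpow hd.le hr.le]
  have e2 : ((d : ℝ) + 1) ^ (-(5 / 4) : ℝ) * ((d : ℝ) + 1) ^ 2 =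
      ((d : ℝ) + 1) * ((d : ℝ) + 1) ^ (-(1 / 4) : ℝ) := by
    rw [← Real.rpow_natCast, ← Real.rpow_add hd]
    nth_rewrite 2 [← Real.rpow_one ((d : ℝ) + 1)]
    rw [← Real.rpow_add hd]
    norm_num
  calc _ = 72 * (|θ| * r ^ (-(1 / 4) : ℝ)) * (((d : ℝ) + 1) * ((d : ℝ) + 1) ^ (-(1 / 4) : ℝ)) := by
        ring
    _ = _ := by rw [← e2]; ring

/-! ### Elementary limits for the saddle point. -/

open MeasureTheory

lemma tendsto_one_add_pow_exp {g : ℕ → ℂ} {k : ℕ → ℕ} {t : ℂ}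
    (hk : Tendsto (fun n => (k n : ℝ)) atTop atTop)
    (hg : Tendsto (fun n => (k n : ℂ) * g n) atTop (𝓝 t)) :
    Tendsto (fun n => (1 + g n) ^ k n) atTop (𝓝 (Complex.exp t)) := by
  have hinv : Tendsto (fun n => ((k n : ℂ))⁻¹) atTop (𝓝 0) := by
    have := (Complex.continuous_ofReal.tendsto 0).comp (tendsto_inv_atTop_zero.comp hk)
    simpa [Function.comp_def] using this
  have hk0 : ∀ᶠ n in atTop, (k n : ℂ) ≠ 0 := by
    filter_upwards [hk.eventually_gt_atTop 0] with n hn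
    exact_mod_cast hn.ne'
  have hg0 : Tendsto g atTop (𝓝 0) := by
    have := hg.mul hinv
    rw [mul_zero] at this
    refine this.congr' ?_
    filter_upwards [hk0] with n hn
    field_simp
  have hg1 : ∀ᶠ n in atTop, ‖g n‖ < 1 / 2 := by
    have := hg0.norm.eventually_lt_const (show ‖(0 : ℂ)‖ < 1 / 2 by norm_num)
    exact this
  have hrem : Tendsto (fun n => (k n : ℂ) * (Complex.log (1 + g n) - g n)) atTop (𝓝 0) := by
    have h1 : Tendsto (fun n => ‖(k n : ℂ) * g n‖ * ‖g n‖) atTop (𝓝 0) := by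
      simpa using hg.norm.mul hg0.norm
    refine squeeze_zero_norm' ?_ h1
    filter_upwards [hg1] with n hn
    have h2 := Complex.norm_log_one_add_sub_self_le (z := g n) (by linarith)
    rw [norm_mul, norm_mul, mul_assoc]
    gcongr
    refine h2.trans ?_
    have h3 : (1 - ‖g n‖)⁻¹ ≤ 2 := by
      rw [inv_le_comm₀ (by linarith) (by norm_num)]
      linarith
    calc ‖g n‖ ^ 2 * (1 - ‖g n‖)⁻¹ / 2 ≤ ‖g n‖ ^ 2 * 2 / 2 := by gcongr
      _ = _ := by ring
  have hlog : Tendsto (fun n => (k n : ℂ) * Complex.log (1 + g n)) atTop (𝓝 t) := by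
    have := hrem.add hg
    rw [zero_add] at this
    refine this.congr fun n => ?_
    ring
  refine ((Complex.continuous_exp.tendsto t).comp hlog).congr' ?_
  filter_upwards [hg1] with n hn
  have h1 : 1 + g n ≠ 0 := by
    intro h
    have : g n = -1 := by linear_combination h
    rw [this] at hn
    norm_num at hn
  simp only [Function.comp_apply]
  rw [Complex.exp_nat_mul, Complex.exp_log h1]

lemma tendsto_mul_log_div : Tendsto (fun r : ℝ => r * Real.log (r / (2 * Real.pi)))
    (𝓝[>] 0) (𝓝 0) := by
  have h1 : Tendsto (fun r : ℝ => r * Real.log r) (𝓝[>] 0) (𝓝 0) := by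
    simpa using (Real.continuous_mul_log.tendsto 0).mono_left nhdsWithin_le_nhds
  have h2 : Tendsto (fun r : ℝ => r * Real.log (2 * Real.pi)) (𝓝[>] 0) (𝓝 0) := by
    have : Continuous fun r : ℝ => r * Real.log (2 * Real.pi) := by fun_prop
    simpa using (this.tendsto 0).mono_left nhdsWithin_le_nhds
  have h3 := h1.sub h2
  rw [sub_zero] at h3
  refine h3.congr' ?_
  filter_upwards [self_mem_nhdsWithin] with r hr
  rw [Real.log_div (ne_of_gt hr) (by positivity)]
  ring

lemma tendsto_mul_Fr : Tendsto (fun r => r * Fr r) (𝓝[>] 0) (𝓝 (Real.pi ^ 2 / 6)) := by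
  have h0 : Tendsto (fun r : ℝ => r) (𝓝[>] 0) (𝓝 0) := tendsto_nhdsWithin_of_tendsto_nhds tendsto_id
  have h1 := ((h0.mul tendsto_Fr_sub).add (tendsto_mul_log_div.const_mul (1 / 2))).add
    (tendsto_const_nhds (x := Real.pi ^ 2 / 6))
  simp only [mul_zero, zero_add] at h1
  refine h1.congr' ?_
  filter_upwards [self_mem_nhdsWithin] with r hr
  have : r ≠ 0 := ne_of_gt hr
  field_simp
  ring

lemma eventually_one_le_mul_Fr : ∀ᶠ r in 𝓝[>] (0 : ℝ), 1 ≤ r * Fr r := by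
  refine tendsto_mul_Fr.eventually_const_le ?_
  nlinarith [Real.pi_gt_three]

lemma tendsto_exp_I_sub (x : ℝ) {k : ℕ → ℕ} (hk : Tendsto (fun n => (k n : ℝ)) atTop atTop) :
    Tendsto (fun n => (k n : ℂ) * (Complex.exp ((x / √(k n) : ℝ) * Complex.I) - 1 -
      (x / √(k n) : ℝ) * Complex.I)) atTop (𝓝 (-(x ^ 2 / 2 : ℝ))) := by
  have hsq : Tendsto (fun n => √(k n)) atTop atTop := Real.tendsto_sqrt_atTop.comp hk
  have hy : Tendsto (fun n => x / √(k n)) atTop (𝓝 0) := hsq.const_div_atTop x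
  have hlim : Tendsto (fun n => |x| ^ 2 * |x / √(k n)|) atTop (𝓝 0) := by
    have := hy.abs.const_mul (|x| ^ 2)
    rwa [abs_zero, mul_zero] at this
  rw [tendsto_iff_norm_sub_tendsto_zero]
  refine squeeze_zero' (Eventually.of_forall fun n => norm_nonneg _) ?_ hlim
  filter_upwards [hk.eventually_gt_atTop 0, hy.abs.eventually_le_const (show |(0 : ℝ)| < 1 by simp)]
    with n hn hy1
  set y := x / √(k n) with hydef
  have hky : (k n : ℝ) * y ^ 2 = x ^ 2 := by
    rw [hydef, div_pow, Real.sq_sqrt hn.le]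
    field_simp
  have hb := Complex.exp_bound (x := y * Complex.I) (by simpa using hy1) (n := 3) (by norm_num)
  have e1 : (k n : ℂ) * (Complex.exp (y * Complex.I) - 1 - y * Complex.I) - -((x ^ 2 / 2 : ℝ) : ℂ) =
      ((k n : ℝ) : ℂ) * (Complex.exp (y * Complex.I) -
        ∑ m ∈ Finset.range 3, (y * Complex.I) ^ m / (m.factorial : ℂ)) := by
    rw [← hky]
    simp only [Finset.sum_range_succ, Finset.sum_range_zero, Nat.factorial, mul_pow, Complex.I_sq]
    push_cast
    ring
  rw [e1, norm_mul, Complex.norm_real, Real.norm_of_nonneg hn.le]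
  simp only [norm_mul, Complex.norm_real, Complex.norm_I, mul_one, Real.norm_eq_abs] at hb
  have hb' : ‖Complex.exp (y * Complex.I) -
        ∑ m ∈ Finset.range 3, (y * Complex.I) ^ m / (m.factorial : ℂ)‖ ≤ |y| ^ 3 := by
    refine hb.trans ?_
    have : ((Nat.succ 3 : ℕ) : ℝ) * (((Nat.factorial 3 : ℕ) : ℝ) * ((3 : ℕ) : ℝ))⁻¹ ≤ 1 := by
      norm_num [Nat.factorial]
    exact mul_le_of_le_one_right (by positivity) this
  calc (k n : ℝ) * _ ≤ (k n : ℝ) * |y| ^ 3 := by gcongr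
    _ = ((k n : ℝ) * y ^ 2) * |y| := by rw [← sq_abs y]; ring
    _ = |x| ^ 2 * |y| := by rw [hky, sq_abs]

/-! ### The rescaled Cauchy integral and its Gaussian limit. -/

section Scaled

variable {k : ℕ → ℕ} {r : ℕ → ℝ} {c : ℝ}

/-- The rescaled integrand of Cauchy's formula. -/
noncomputable def scaled (k : ℕ) (r x : ℝ) : ℂ :=
  (evalF (Complex.exp (-(r + (r * (x / √k) : ℝ) * Complex.I))) / Fr r) ^ k *
    Complex.exp ((√k * x : ℝ) * Complex.I)

/-- The quantity equals √(kr) r^{1/4}. It is the size of k times the relative error from slow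
variation at θ = r x/√k. -/
lemma tendsto_sqrt_mul_rpow (hr : Tendsto r atTop (𝓝[>] 0))
    (hkr : Tendsto (fun n => (k n : ℝ) * r n) atTop (𝓝 c)) :
    Tendsto (fun n => √(k n) * r n ^ (3 / 4 : ℝ)) atTop (𝓝 0) := by
  have hr0 : Tendsto r atTop (𝓝 0) := hr.mono_right nhdsWithin_le_nhds
  have h1 : Tendsto (fun n => r n ^ (1 / 4 : ℝ)) atTop (𝓝 0) := by
    have := hr0.rpow_const (p := 1 / 4) (Or.inr (by norm_num))
    rwa [Real.zero_rpow (by norm_num)] at this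
  have h2 : Tendsto (fun n => √((k n : ℝ) * r n)) atTop (𝓝 √c) := hkr.sqrt
  have h3 := h2.mul h1
  rw [mul_zero] at h3
  refine h3.congr' ?_
  filter_upwards [hr.eventually self_mem_nhdsWithin] with n hn
  rw [Real.sqrt_mul (by positivity), Real.sqrt_eq_rpow (r n), mul_assoc,
    ← Real.rpow_add (by exact hn)]
  norm_num

/-- With y = x/√k, slow variation replaces the ratio of F-values by 1/(1 + iy), and (e^{iy}/(1 +
iy))^k tends to e^{-x²/2} since e^{iy} - 1 - iy ≈ -y²/2. -/
lemma tendsto_scaled (hk : Tendsto (fun n => (k n : ℝ)) atTop atTop)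
    (hr : Tendsto r atTop (𝓝[>] 0)) (hkr : Tendsto (fun n => (k n : ℝ) * r n) atTop (𝓝 c)) (x : ℝ) :
    Tendsto (fun n => scaled (k n) (r n) x) atTop (𝓝 (Complex.exp (-(x ^ 2 / 2 : ℝ)))) := by
  obtain ⟨C, hC0, hC⟩ := exists_norm_mul_evalF_sub_le
  have hy : Tendsto (fun n => x / √(k n)) atTop (𝓝 0) :=
    (Real.tendsto_sqrt_atTop.comp hk).const_div_atTop x
  let ε : ℕ → ℂ := fun n => ((r n + (r n * (x / √(k n)) : ℝ) * Complex.I) *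
    evalF (Complex.exp (-(r n + (r n * (x / √(k n)) : ℝ) * Complex.I))) - r n * Fr (r n)) /
      (r n * Fr (r n))
  have hε : Tendsto (fun n => (k n : ℂ) * ε n) atTop (𝓝 0) := by
    have h1 : Tendsto (fun n => C * |x| * (√(k n) * r n ^ (3 / 4 : ℝ))) atTop (𝓝 0) := by
      simpa using (tendsto_sqrt_mul_rpow hr hkr).const_mul (C * |x|)
    refine squeeze_zero_norm' ?_ h1
    filter_upwards [hr.eventually self_mem_nhdsWithin, hr.eventually eventually_one_le_mul_Fr,
      hk.eventually_gt_atTop 0, hy.abs.eventually_le_const (show |(0 : ℝ)| < 1 by simp)]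
      with n hrn hF hkn hyn
    have hrn' : 0 < r n := hrn
    have h2 := hC (r n) (r n * (x / √(k n))) hrn' (by
      rw [abs_mul, abs_of_pos hrn']
      exact mul_le_of_le_one_right hrn'.le hyn)
    have h3 : ‖((r n : ℂ) * Fr (r n))‖ = r n * Fr (r n) := by
      rw [← Complex.ofReal_mul, Complex.norm_real, Real.norm_of_nonneg (by linarith)]
    rw [norm_mul, Complex.norm_natCast]
    simp only [ε]
    rw [norm_div, h3]
    have h4 : (k n : ℝ) = √(k n) * √(k n) := (Real.mul_self_sqrt hkn.le).symm
    have h5 : r n * r n ^ (-(1 / 4) : ℝ) = r n ^ (3 / 4 : ℝ) := by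
      nth_rewrite 1 [← Real.rpow_one (r n)]
      rw [← Real.rpow_add hrn']
      norm_num
    have hs : 0 < √(k n : ℝ) := Real.sqrt_pos.2 hkn
    calc _ ≤ (k n : ℝ) * (C * (|r n * (x / √(k n))| * r n ^ (-(1 / 4) : ℝ)) / 1) := by gcongr
      _ = (√(k n) * √(k n)) * (C * (|x| / √(k n) * (r n * r n ^ (-(1 / 4) : ℝ)))) := by
        rw [← h4, abs_mul, abs_of_pos hrn', abs_div, abs_of_pos hs]
        ring
      _ = _ := by rw [h5]; field_simp
  let h : ℕ → ℂ := fun n => (Complex.exp ((x / √(k n) : ℝ) * Complex.I) - 1 -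
      (x / √(k n) : ℝ) * Complex.I) / (1 + (x / √(k n) : ℝ) * Complex.I)
  have hden : Tendsto (fun n => (1 + (x / √(k n) : ℝ) * Complex.I : ℂ)) atTop (𝓝 1) := by
    have := (((Complex.continuous_ofReal.tendsto 0).comp hy).mul_const Complex.I).const_add 1
    simpa [Function.comp_def] using this
  have hh : Tendsto (fun n => (k n : ℂ) * h n) atTop (𝓝 (-(x ^ 2 / 2 : ℝ))) := by
    have := (tendsto_exp_I_sub x hk).div hden one_ne_zero
    rw [div_one] at this
    refine this.congr fun n => ?_
    simp only [h, Pi.div_apply]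
    rw [mul_div_assoc]
  have hexp : Tendsto (fun n => Complex.exp ((x / √(k n) : ℝ) * Complex.I)) atTop (𝓝 1) := by
    have h1 := ((Complex.continuous_ofReal.tendsto 0).comp hy).mul_const Complex.I
    have h2 := (Complex.continuous_exp.tendsto _).comp h1
    simpa [Function.comp_def] using h2
  -- The base of the k-th power is (1 + ε) e^{iy}/(1 + iy), where e^{iy}/(1 + iy) = 1 + h; this is
  -- its deviation from 1.
  have hg : Tendsto (fun n => (k n : ℂ) * (h n + ε n * (Complex.exp ((x / √(k n) : ℝ) * Complex.I) /
      (1 + (x / √(k n) : ℝ) * Complex.I)))) atTop (𝓝 (-(x ^ 2 / 2 : ℝ))) := by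
    have := hh.add (hε.mul (hexp.div hden one_ne_zero))
    rw [zero_mul, add_zero] at this
    refine this.congr fun n => ?_
    simp only [Pi.div_apply]
    ring
  refine (tendsto_one_add_pow_exp hk hg).congr' ?_
  filter_upwards [hr.eventually self_mem_nhdsWithin, hr.eventually eventually_one_le_mul_Fr,
      hk.eventually_gt_atTop 0, hden.eventually_ne one_ne_zero] with n hrn hF hkn hd
  have hrn' : (r n : ℂ) ≠ 0 := by exact_mod_cast (ne_of_gt hrn)
  have hF' : (Fr (r n) : ℂ) ≠ 0 := by
    intro h
    rw [Complex.ofReal_eq_zero] at h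
    rw [h] at hF
    norm_num at hF
  have hs : 0 < √(k n : ℝ) := Real.sqrt_pos.2 hkn
  have e1 : Complex.exp ((√(k n) * x : ℝ) * Complex.I) =
      Complex.exp ((x / √(k n) : ℝ) * Complex.I) ^ k n := by
    rw [← Complex.exp_nat_mul]
    congr 1
    rw [← mul_assoc, ← Complex.ofReal_natCast, ← Complex.ofReal_mul]
    congr 2
    have h4 : (k n : ℝ) = √(k n) * √(k n) := (Real.mul_self_sqrt hkn.le).symm
    nth_rewrite 2 [h4]
    field_simp
  rw [scaled, e1, ← mul_pow]
  congr 1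
  simp only [h, ε]
  generalize evalF _ = w
  rw [Complex.ofReal_mul]
  generalize ((x / √(k n) : ℝ) : ℂ) = y at *
  generalize Complex.exp (y * Complex.I) = E
  field_simp
  ring

/-- By 1 - u ≤ e^{-u}, the k-th power is at most exp(-min(x², k)/288); the two summands cover the
two cases. -/
lemma norm_evalF_le_pow_bound {k : ℕ} {r x : ℝ} (hk : 0 < k) (hr : 0 < r) (hF : 0 < Fr r)
    (hb : ∀ θ : ℝ, |θ| ≤ Real.pi →
      ‖evalF (Complex.exp (-(r + θ * Complex.I)))‖ ≤ (1 - min ((θ / r) ^ 2) 1 / 288) * Fr r)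
    (hx : |x| ≤ Real.pi * √k / r) :
    ‖scaled k r x‖ ≤ Real.exp (-(1 / 288) * x ^ 2) + Real.exp (-(k / 288)) := by
  have hs : 0 < √(k : ℝ) := Real.sqrt_pos.2 (by exact_mod_cast hk)
  have h1 := hb (r * (x / √k)) (by
    rw [abs_mul, abs_div, abs_of_pos hr, abs_of_pos hs]
    calc r * (|x| / √k) ≤ r * ((Real.pi * √k / r) / √k) := by gcongr
      _ = Real.pi := by field_simp)
  rw [mul_div_cancel_left₀ _ hr.ne', div_pow, Real.sq_sqrt (Nat.cast_nonneg k)] at h1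
  rw [scaled, norm_mul, Complex.norm_exp_ofReal_mul_I, mul_one, norm_pow, norm_div,
    Complex.norm_real, Real.norm_of_nonneg hF.le]
  have h2 : ‖evalF (Complex.exp (-(r + (r * (x / √k) : ℝ) * Complex.I)))‖ / Fr r ≤
      1 - min (x ^ 2 / k) 1 / 288 := by
    rwa [div_le_iff₀ hF]
  have hk' : (0 : ℝ) < k := by exact_mod_cast hk
  have h3 : 1 - min (x ^ 2 / k) 1 / 288 ≤ Real.exp (-(min (x ^ 2 / k) 1 / 288)) := by
    linarith [Real.add_one_le_exp (-(min (x ^ 2 / k) 1 / 288))]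
  calc _ ≤ Real.exp (-(min (x ^ 2 / k) 1 / 288)) ^ k :=
        pow_le_pow_left₀ (by positivity) (h2.trans h3) k
    _ = Real.exp (-(k * min (x ^ 2 / k) 1 / 288)) := by
        rw [← Real.exp_nat_mul]; ring_nf
    _ ≤ _ := by
      rcases le_total (x ^ 2 / k) 1 with h | h
      · rw [min_eq_left h]
        have : -(k * (x ^ 2 / k) / 288) = -(1 / 288) * x ^ 2 := by field_simp
        rw [this]
        linarith [Real.exp_pos (-((k : ℝ) / 288))]
      · rw [min_eq_right h, mul_one]
        linarith [Real.exp_pos (-(1 / 288) * x ^ 2)]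

/-- The squared half-length π²k/r² equals π²k³/(kr)², which grows only like k³ and loses against the
exponential. -/
lemma eventually_exp_neg_mul_le (hk : Tendsto (fun n => (k n : ℝ)) atTop atTop)
    (hr : Tendsto r atTop (𝓝[>] 0)) (hc : 0 < c)
    (hkr : Tendsto (fun n => (k n : ℝ) * r n) atTop (𝓝 c)) :
    ∀ᶠ n in atTop, Real.exp (-((k n : ℝ) / 288)) * (1 + (Real.pi * √(k n) / r n) ^ 2) ≤ 1 := by
  have hu : Tendsto (fun n => (k n : ℝ) / 288) atTop atTop := hk.atTop_div_const (by norm_num)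
  have h0 := (Real.tendsto_pow_mul_exp_neg_atTop_nhds_zero 0).comp hu
  have h3 := (Real.tendsto_pow_mul_exp_neg_atTop_nhds_zero 3).comp hu
  have h4 := h0.add ((h3.mul ((hkr.pow 2).inv₀ (by positivity))).const_mul (Real.pi ^ 2 * 288 ^ 3))
  simp only [zero_mul, mul_zero, add_zero] at h4
  filter_upwards [h4.eventually_le_const one_pos, hr.eventually self_mem_nhdsWithin,
    hk.eventually_gt_atTop 0] with n hn hrn hkn
  have hrn' : 0 < r n := hrn
  refine le_trans (le_of_eq ?_) hn
  simp only [Function.comp_apply, pow_zero, one_mul]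
  rw [div_pow, mul_pow, Real.sq_sqrt hkn.le]
  field_simp

lemma continuous_evalF_exp {r : ℝ} (hr : 0 < r) :
    Continuous fun θ : ℝ => evalF (Complex.exp (-(r + θ * Complex.I))) := by
  have hz : ‖Complex.exp (-r)‖ < 1 := by
    rw [Complex.norm_exp]; simpa using hr
  refine continuous_tsum (fun m => by fun_prop) (summable_norm_coeff_F hz) fun m θ => le_of_eq ?_
  simp only [norm_mul, norm_pow, Complex.norm_exp]
  simp

lemma continuous_scaled {k : ℕ} {r : ℝ} (hr : 0 < r) : Continuous (scaled k r) := by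
  have h1 : Continuous fun x : ℝ => r * (x / √k) := by fun_prop
  have h2 := (continuous_evalF_exp hr).comp h1
  unfold scaled
  exact ((h2.div_const _).pow k).mul (by fun_prop)

/-- Dominated convergence: on the interval of integration the constant tail e^{-k/288} lies below
1/(1 + x²), which gives a majorant independent of n. -/
lemma tendsto_integral_scaled (hk : Tendsto (fun n => (k n : ℝ)) atTop atTop)
    (hr : Tendsto r atTop (𝓝[>] 0)) (hc : 0 < c)
    (hkr : Tendsto (fun n => (k n : ℝ) * r n) atTop (𝓝 c)) :
    Tendsto (fun n => ∫ x in (-(Real.pi * √(k n) / r n))..(Real.pi * √(k n) / r n),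
      scaled (k n) (r n) x) atTop (𝓝 (√(2 * Real.pi) : ℝ)) := by
  have hgauss : ∫ x : ℝ, Complex.exp (-(x ^ 2 / 2 : ℝ)) = (√(2 * Real.pi) : ℝ) := by
    have h1 := integral_gaussian (1 / 2)
    rw [show Real.pi / (1 / 2) = 2 * Real.pi by ring] at h1
    rw [← h1, ← integral_complex_ofReal]
    congr 1
    ext x
    push_cast
    congr 1
    ring
  rw [← hgauss]
  have hlim : Tendsto (fun n => ∫ x : ℝ, (Set.Ioc (-(Real.pi * √(k n) / r n))
      (Real.pi * √(k n) / r n)).indicator (scaled (k n) (r n)) x) atTop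
      (𝓝 (∫ x : ℝ, Complex.exp (-(x ^ 2 / 2 : ℝ)))) := by
    refine tendsto_integral_filter_of_dominated_convergence
      (fun x => Real.exp (-(1 / 288) * x ^ 2) + (1 + x ^ 2)⁻¹) ?_ ?_ ?_ ?_
    · filter_upwards [hr.eventually self_mem_nhdsWithin] with n hn
      exact ((continuous_scaled hn).measurable.indicator measurableSet_Ioc).aestronglyMeasurable
    · filter_upwards [hr.eventually self_mem_nhdsWithin, hr.eventually eventually_norm_evalF_le,
        hr.eventually eventually_one_le_mul_Fr, hk.eventually_gt_atTop 0,
        eventually_exp_neg_mul_le hk hr hc hkr] with n hrn hb hF hkn he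
      refine Eventually.of_forall fun x => ?_
      have hrn' : 0 < r n := hrn
      by_cases hx : x ∈ Set.Ioc (-(Real.pi * √(k n) / r n)) (Real.pi * √(k n) / r n)
      · rw [Set.indicator_of_mem hx]
        have hx' : |x| ≤ Real.pi * √(k n) / r n := abs_le.2 ⟨hx.1.le, hx.2⟩
        refine (norm_evalF_le_pow_bound (by exact_mod_cast hkn) hrn' ?_ hb hx').trans ?_
        · exact pos_of_mul_pos_right (by linarith) hrn'.le
        · gcongr
          rw [le_inv_comm₀ (Real.exp_pos _) (by positivity), ← one_div, le_div_iff₀ (Real.exp_pos _),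
            mul_comm]
          refine le_trans ?_ he
          have : x ^ 2 ≤ (Real.pi * √(k n) / r n) ^ 2 := by
            rw [← sq_abs]; gcongr
          gcongr
      · rw [Set.indicator_of_notMem hx, norm_zero]
        positivity
    · exact (integrable_exp_neg_mul_sq (by norm_num)).add integrable_inv_one_add_sq
    · refine Eventually.of_forall fun x => ?_
      refine (tendsto_scaled hk hr hkr x).congr' ?_
      have hR : Tendsto (fun n => Real.pi * √(k n) / r n) atTop atTop := by
        have h1 : Tendsto (fun n => (r n)⁻¹) atTop atTop := tendsto_inv_nhdsGT_zero.comp hr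
        have h2 := ((Real.tendsto_sqrt_atTop.comp hk).const_mul_atTop Real.pi_pos).atTop_mul_atTop₀ h1
        exact h2
      filter_upwards [hR.eventually_gt_atTop |x|] with n hn
      rw [Set.indicator_of_mem]
      exact ⟨(abs_lt.1 hn).1, (abs_lt.1 hn).2.le⟩
  refine hlim.congr' ?_
  filter_upwards [hr.eventually self_mem_nhdsWithin] with n hn
  have hn' : 0 < r n := hn
  have hR : 0 ≤ Real.pi * √(k n) / r n := by positivity
  rw [integral_indicator measurableSet_Ioc, intervalIntegral.integral_of_le (by linarith)]

/-- Rescaling Cauchy's formula. -/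
lemma coeff_F_pow_eq {n k : ℕ} (hn : 0 < n) (hk : 0 < k) (hF : 0 < Fr (k / n)) :
    ((coeff n (F ^ k) : ℝ) : ℂ) = ((Fr (k / n) ^ k * Real.exp k * (√k / n) / (2 * Real.pi) : ℝ) : ℂ) *
      ∫ x in (-(Real.pi * √k / (k / n)))..(Real.pi * √k / (k / n)), scaled k (k / n) x := by
  have hn' : (0 : ℝ) < n := by exact_mod_cast hn
  have hk' : (0 : ℝ) < k := by exact_mod_cast hk
  have hs : 0 < √(k : ℝ) := Real.sqrt_pos.2 hk'
  have hss : √(k : ℝ) * √k = k := Real.mul_self_sqrt hk'.le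
  set r : ℝ := k / n with hr
  have hr0 : 0 < r := by positivity
  -- This choice of radius turns e^{nr} into e^k and e^{inθ} into e^{i√k x}.
  have hnr : (n : ℝ) * r = k := by rw [hr]; field_simp
  have h1 := integral_evalF_pow hr0 n k
  have h2 := intervalIntegral.integral_comp_mul_left (a := -(Real.pi * √k / r)) (b := Real.pi * √k / r)
    (fun θ : ℝ => evalF (Complex.exp (-(r + θ * Complex.I))) ^ k * Complex.exp (n * (θ * Complex.I)))
    (c := r / √k) (by positivity)
  have e1 : r / √k * (Real.pi * √k / r) = Real.pi := by field_simp
  rw [mul_neg, e1, h1] at h2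
  have hF' : (Fr r : ℂ) ≠ 0 := by exact_mod_cast hF.ne'
  have h3 : ∀ x : ℝ, evalF (Complex.exp (-(r + (r / √k * x : ℝ) * Complex.I))) ^ k *
      Complex.exp (n * ((r / √k * x : ℝ) * Complex.I)) = (Fr r : ℂ) ^ k * scaled k r x := by
    intro x
    have e2 : r / √k * x = r * (x / √k) := by ring
    have e3 : (n : ℂ) * ((r * (x / √k) : ℝ) * Complex.I) = (√k * x : ℝ) * Complex.I := by
      rw [← mul_assoc, ← Complex.ofReal_natCast, ← Complex.ofReal_mul]
      congr 2
      rw [← mul_assoc, hnr]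
      nth_rewrite 1 [← hss]
      field_simp
    rw [e2, e3, scaled, div_pow]
    field_simp
  simp only [h3] at h2
  rw [intervalIntegral.integral_const_mul] at h2
  have e4 : Complex.exp (-(n * r)) = ((Real.exp k)⁻¹ : ℝ) := by
    rw [← Real.exp_neg, Complex.ofReal_exp]
    congr 1
    rw [← hnr]
    push_cast
    ring
  rw [e4, Complex.real_smul] at h2
  generalize (∫ x in (-(Real.pi * √k / r))..(Real.pi * √k / r), scaled k r x) = J at *
  have hpi : (Real.pi : ℂ) ≠ 0 := by exact_mod_cast Real.pi_ne_zero
  have he : (Real.exp k : ℂ) ≠ 0 := by exact_mod_cast (Real.exp_pos k).ne'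
  have hr' : (r : ℂ) ≠ 0 := by exact_mod_cast hr0.ne'
  have hs' : ((√(k : ℝ) : ℝ) : ℂ) ≠ 0 := by exact_mod_cast hs.ne'
  have e5 : √(k : ℝ) / n = r / √k := by
    rw [div_eq_div_iff hn'.ne' hs.ne', hss, hr]
    field_simp
  rw [e5]
  push_cast at h2 ⊢
  have h5 : (Fr r : ℂ) ^ k * J * Complex.exp k * (r / (√(k : ℝ) : ℝ)) =
      2 * Real.pi * ((coeff n (F ^ k) : ℝ) : ℂ) := by
    rw [h2]
    have : Complex.exp k ≠ 0 := Complex.exp_ne_zero _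
    field_simp
  have h6 : ((coeff n (F ^ k) : ℝ) : ℂ) =
      (Fr r : ℂ) ^ k * J * Complex.exp k * (r / (√(k : ℝ) : ℝ)) / (2 * Real.pi) := by
    rw [h5]; field_simp
  rw [h6]
  ring

end Scaled

/-! ### The constants and the main term in closed form. -/

lemma I1log_eq : (I1log : ℂ) = -riemannZeta 0 / riemannZeta 2 := by
  have hpi : (Real.pi : ℂ) ≠ 0 := by exact_mod_cast Real.pi_ne_zero
  rw [riemannZeta_zero, riemannZeta_two, I1log]
  push_cast
  field_simp
  norm_num

lemma I1_eq : (I1 : ℂ) = deriv riemannZeta 0 / riemannZeta 2 := by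
  have hpi : (Real.pi : ℂ) ≠ 0 := by exact_mod_cast Real.pi_ne_zero
  have hlog : Complex.log (2 * Real.pi) = (Real.log (2 * Real.pi) : ℝ) := by
    rw [Complex.ofReal_log (by positivity)]
    push_cast
    rfl
  rw [deriv_riemannZeta_zero, riemannZeta_two, hlog, I1]
  push_cast
  field_simp
  ring

lemma K_two : K 2 = Real.pi ^ 2 / 6 := by
  have h : riemannZeta ((2 : ℕ) : ℂ) = ((Real.pi ^ 2 / 6 : ℝ) : ℂ) := by
    push_cast
    exact riemannZeta_two
  simp only [K, Finset.Icc_self, Finset.prod_singleton]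
  rw [h, Complex.ofReal_re]
  simp

lemma exp_S_two {n k : ℕ} (hn : 0 < n) (hk : 0 < k) : Real.exp (S 2 n k) =
    ((n : ℝ) * Real.exp 2 * (Real.pi ^ 2 / 6) / (k : ℝ) ^ 2) ^ k := by
  have hn' : (0 : ℝ) < n := by exact_mod_cast hn
  have hk' : (0 : ℝ) < k := by exact_mod_cast hk
  have hpi := Real.pi_pos
  have h0 : 0 < (n : ℝ) * Real.exp 2 * (Real.pi ^ 2 / 6) / (k : ℝ) ^ 2 := by positivity
  have h1 : S 2 n k = k * Real.log ((n : ℝ) * Real.exp 2 * (Real.pi ^ 2 / 6) / (k : ℝ) ^ 2) := by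
    rw [Real.log_div (by positivity) (by positivity), Real.log_mul (by positivity) (by positivity),
      Real.log_mul (by positivity) (by positivity), Real.log_exp, Real.log_pow, S, K_two]
    push_cast
    rw [show (2 : ℝ) - 1 = 1 by norm_num, Real.log_one]
    ring
  rw [h1, Real.exp_nat_mul, Real.exp_log h0]

lemma E₂_eq {u : ℝ} (hu : 0 < u) :
    E₂ u = 3 / Real.pi ^ 2 * (u * Real.log (u / (2 * Real.pi))) := by
  rw [E₂, I1log, I1, Real.log_div hu.ne' (by positivity)]
  ring

lemma abs_log_one_add_sub_le {x : ℝ} (hx : |x| ≤ 1 / 2) : |Real.log (1 + x) - x| ≤ 2 * x ^ 2 := by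
  obtain ⟨h1, h2⟩ := abs_le.1 hx
  have h0 : 0 < 1 + x := by linarith
  have h3 := Real.log_le_sub_one_of_pos h0
  have h4 := Real.one_sub_inv_le_log_of_pos h0
  have h5 : 1 - (1 + x)⁻¹ - x ≥ -(2 * x ^ 2) := by
    have : 1 - (1 + x)⁻¹ - x = -(x ^ 2 / (1 + x)) := by field_simp; ring
    rw [this, ge_iff_le, neg_le_neg_iff, div_le_iff₀ h0]
    nlinarith [sq_nonneg x]
  rw [abs_le]
  constructor <;> nlinarith [sq_nonneg x]

/-- Controls the quadratic error: k (r log r)² is kr times (√r log r)². -/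
lemma tendsto_sqrt_mul_log_div : Tendsto (fun r : ℝ => √r * Real.log (r / (2 * Real.pi)))
    (𝓝[>] 0) (𝓝 0) := by
  have h1 := tendsto_log_mul_rpow_nhdsGT_zero (r := 1 / 2) (by norm_num)
  have h2 : Tendsto (fun r : ℝ => √r * Real.log (2 * Real.pi)) (𝓝[>] 0) (𝓝 0) := by
    have : Continuous fun r : ℝ => √r * Real.log (2 * Real.pi) := by fun_prop
    simpa using (this.tendsto 0).mono_left nhdsWithin_le_nhds
  have h3 := h1.sub h2
  rw [sub_zero] at h3
  refine h3.congr' ?_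
  filter_upwards [self_mem_nhdsWithin] with r hr
  rw [Real.log_div (ne_of_gt hr) (by positivity), Real.sqrt_eq_rpow]
  ring

/-! ### Assembling the asymptotics. -/

section Sequences

variable {k : ℕ → ℕ} {r : ℕ → ℝ} {c : ℝ}

/-- By the expansion of `Fr`, the relative defect δ is E₂(r) plus r·o(1). Multiplied by k, the last
term vanishes because kr converges, and so does the error of log(1 + δ) ≈ δ, which is at most 2kδ².
-/
lemma tendsto_mul_log_sub (hr : Tendsto r atTop (𝓝[>] 0))
    (hkr : Tendsto (fun n => (k n : ℝ) * r n) atTop (𝓝 c)) :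
    Tendsto (fun n => (k n : ℝ) * Real.log (r n * Fr (r n) / (Real.pi ^ 2 / 6)) -
      k n * E₂ (r n)) atTop (𝓝 0) := by
  have hpi := Real.pi_pos
  let D : ℝ → ℝ := fun r => Fr r - (Real.pi ^ 2 / (6 * r) + 1 / 2 * Real.log (r / (2 * Real.pi)))
  let δ : ℝ → ℝ := fun r => r * Fr r / (Real.pi ^ 2 / 6) - 1
  have hD : Tendsto (fun n => D (r n)) atTop (𝓝 0) := tendsto_Fr_sub.comp hr
  have hδ0 : Tendsto (fun n => δ (r n)) atTop (𝓝 0) := by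
    have h1 := ((tendsto_mul_Fr.comp hr).div_const (Real.pi ^ 2 / 6)).sub_const 1
    rwa [div_self (by positivity), sub_self] at h1
  have hδ : ∀ r > 0, δ r = 6 / Real.pi ^ 2 * (r * D r) +
      3 / Real.pi ^ 2 * (r * Real.log (r / (2 * Real.pi))) := by
    intro r hr
    simp only [δ, D]
    field_simp
    ring
  have hlin : Tendsto (fun n => (k n : ℝ) * (δ (r n) - E₂ (r n))) atTop (𝓝 0) := by
    have h1 := (hkr.mul hD).const_mul (6 / Real.pi ^ 2)
    rw [mul_zero, mul_zero] at h1
    refine h1.congr' ?_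
    filter_upwards [hr.eventually self_mem_nhdsWithin] with n hn
    rw [hδ _ hn, E₂_eq hn]
    ring
  have hsq : Tendsto (fun n => 2 * ((k n : ℝ) * δ (r n) ^ 2)) atTop (𝓝 0) := by
    have hs : Tendsto (fun n => √(r n)) atTop (𝓝 0) := by
      simpa using (hr.mono_right nhdsWithin_le_nhds).sqrt
    have h1 := ((hs.mul hD).const_mul (6 / Real.pi ^ 2)).add
      ((tendsto_sqrt_mul_log_div.comp hr).const_mul (3 / Real.pi ^ 2))
    simp only [mul_zero, add_zero] at h1
    have h2 := ((hkr.mul (h1.pow 2)).const_mul 2)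
    rw [zero_pow two_ne_zero, mul_zero, mul_zero] at h2
    refine h2.congr' ?_
    filter_upwards [hr.eventually self_mem_nhdsWithin] with n hn
    have hn' : 0 < r n := hn
    rw [hδ _ hn]
    simp only [Function.comp_apply]
    have h3 : √(r n) ^ 2 = r n := Real.sq_sqrt hn'.le
    have h4 : 6 / Real.pi ^ 2 * (√(r n) * D (r n)) +
        3 / Real.pi ^ 2 * (√(r n) * Real.log (r n / (2 * Real.pi))) =
        √(r n) * (6 / Real.pi ^ 2 * D (r n) +
          3 / Real.pi ^ 2 * Real.log (r n / (2 * Real.pi))) := by ring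
    rw [h4, mul_pow, h3]
    ring
  have hquad : Tendsto (fun n => (k n : ℝ) * (Real.log (1 + δ (r n)) - δ (r n))) atTop (𝓝 0) := by
    refine squeeze_zero_norm' ?_ hsq
    filter_upwards [hδ0.abs.eventually_le_const (show |(0 : ℝ)| < 1 / 2 by simp)] with n hn
    rw [norm_mul, Real.norm_eq_abs, Real.norm_eq_abs, Nat.abs_cast, mul_left_comm]
    gcongr
    exact abs_log_one_add_sub_le hn
  have h5 := hquad.add hlin
  rw [add_zero] at h5
  refine h5.congr fun n => ?_
  simp only [δ, add_sub_cancel]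
  ring

lemma tendsto_stirling_ratio (hk : Tendsto (fun n => (k n : ℝ)) atTop atTop) :
    Tendsto (fun n => √(2 * k n * Real.pi) * (k n / Real.exp 1) ^ k n / (k n).factorial)
      atTop (𝓝 1) := by
  have hk' : Tendsto k atTop atTop := tendsto_natCast_atTop_iff.1 hk
  have h1 := (isEquivalent_iff_tendsto_one (Eventually.of_forall fun n => by positivity)).1
    Stirling.factorial_isEquivalent_stirling.symm
  exact h1.comp hk'

/-- The coefficient formula compared with the main term. -/
lemma A_two_eq_mul {n k : ℕ} (hn : 0 < n) (hk : 0 < k) (hF : 0 < Fr (k / n)) :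
    (A 2 n k : ℝ) = (√(2 * k * Real.pi) * (k / Real.exp 1) ^ k / k.factorial) *
      ((∫ x in (-(Real.pi * √k / (k / n)))..(Real.pi * √k / (k / n)), scaled k (k / n) x).re /
        √(2 * Real.pi)) *
      Real.exp ((k : ℝ) * Real.log ((k / n : ℝ) * Fr (k / n) / (Real.pi ^ 2 / 6)) -
        k * E₂ (k / n)) *
      (1 / (2 * Real.pi) * ((n - 1).factorial : ℝ) * Real.exp (S 2 n k + k * E₂ (k / n))) := by
  have hn' : (0 : ℝ) < n := by exact_mod_cast hn
  have hk' : (0 : ℝ) < k := by exact_mod_cast hk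
  have hpi := Real.pi_pos
  have h1 := congrArg Complex.re (coeff_F_pow_eq hn hk hF)
  rw [Complex.ofReal_re, Complex.re_ofReal_mul] at h1
  rw [A_two_eq_coeff, h1]
  generalize (∫ x in (-(Real.pi * √k / (k / n)))..(Real.pi * √k / (k / n)), scaled k (k / n) x).re = J
  rw [Real.exp_add, exp_S_two hn hk, Real.exp_sub, Real.exp_nat_mul,
    Real.exp_log (by positivity)]
  have h2 : (n.factorial : ℝ) = n * (n - 1).factorial := by
    rw [← Nat.cast_mul, Nat.mul_factorial_pred hn.ne']
  have h3 : √(2 * k * Real.pi) = √(2 * Real.pi) * √k := by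
    rw [← Real.sqrt_mul (by positivity)]
    ring_nf
  have h4 : Real.exp k = Real.exp 1 ^ k := by
    rw [← Real.exp_nat_mul, mul_one]
  have h5 : Real.exp 2 = Real.exp 1 ^ 2 := by
    rw [← Real.exp_nat_mul]; norm_num
  have hfac : (k.factorial : ℝ) ≠ 0 := by positivity
  have hE := Real.exp_ne_zero ((k : ℝ) * E₂ (k / n))
  have hs : √(2 * Real.pi) ≠ 0 := by positivity
  have he := Real.exp_ne_zero 1
  -- The k-th powers from Stirling's formula, from the relative correction and from exp(S) combine
  -- exactly to the saddle value F^k e^k.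
  have hbase : (k / Real.exp 1 : ℝ) ^ k * ((k / n : ℝ) * Fr (k / n) / (Real.pi ^ 2 / 6)) ^ k *
      ((n : ℝ) * Real.exp 2 * (Real.pi ^ 2 / 6) / (k : ℝ) ^ 2) ^ k =
      Fr (k / n) ^ k * Real.exp k := by
    rw [h4, h5, ← mul_pow, ← mul_pow, ← mul_pow]
    congr 1
    field_simp
  rw [h2, h3]
  calc _ = ((n - 1).factorial : ℝ) * √k * J / (2 * Real.pi * k.factorial) *
        (Fr (k / n) ^ k * Real.exp k) := by
        field_simp
    _ = _ := by
        rw [← hbase]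
        generalize (k / Real.exp 1 : ℝ) ^ k = x
        generalize ((k / n : ℝ) * Fr (k / n) / (Real.pi ^ 2 / 6)) ^ k = y
        generalize ((n : ℝ) * Real.exp 2 * (Real.pi ^ 2 / 6) / (k : ℝ) ^ 2) ^ k = z
        field_simp

lemma A_two_isEquivalent (hk1 : ∀ n : ℕ, 1 ≤ n → 1 ≤ k n)
    (hk : Tendsto (fun n => (k n : ℝ)) atTop atTop)
    (hr : Tendsto (fun n => (k n / n : ℝ)) atTop (𝓝[>] 0)) (hc : 0 < c)
    (hkr : Tendsto (fun n => (k n : ℝ) * (k n / n)) atTop (𝓝 c)) :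
    (fun n : ℕ => (A 2 n (k n) : ℝ)) ~[atTop]
        (fun n : ℕ => 1 / (2 * Real.pi) * ((n - 1).factorial : ℝ) *
          Real.exp (S 2 n (k n) + (k n : ℝ) * E₂ ((k n : ℝ) / (n : ℝ)))) := by
  have hJ := ((Complex.continuous_re.tendsto _).comp
    (tendsto_integral_scaled hk hr hc hkr)).div_const (√(2 * Real.pi))
  rw [Complex.ofReal_re, div_self (by positivity)] at hJ
  have hE := (Real.continuous_exp.tendsto 0).comp (tendsto_mul_log_sub hr hkr)
  rw [Real.exp_zero] at hE
  have h := ((tendsto_stirling_ratio hk).mul hJ).mul hE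
  rw [one_mul, one_mul] at h
  rw [isEquivalent_iff_exists_eq_mul]
  refine ⟨_, h, ?_⟩
  filter_upwards [eventually_ge_atTop 1, hr.eventually eventually_one_le_mul_Fr,
    hr.eventually self_mem_nhdsWithin] with n hn hF hrn
  have hrn' : (0 : ℝ) < k n / n := hrn
  exact A_two_eq_mul hn (hk1 n hn) (pos_of_mul_pos_right (by linarith) hrn'.le)

end Sequences

end CommPerm

theorem theorem2 :
    ((CommPerm.I1log : ℂ) = -riemannZeta 0 / riemannZeta 2 ∧
      (CommPerm.I1 : ℂ) = deriv riemannZeta 0 / riemannZeta 2) ∧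
    ∀ s : ℝ, 0 < s → s < 1 → ∀ k : ℕ → ℕ, (∀ n : ℕ, 1 ≤ n → 1 ≤ k n ∧ k n ≤ n) →
      (fun n : ℕ => (k n : ℝ)) ~[atTop] (fun n : ℕ => s * (n : ℝ) ^ ((1 : ℝ) / 2)) →
      (fun n : ℕ => (CommPerm.A 2 n (k n) : ℝ)) ~[atTop]
        (fun n : ℕ => 1 / (2 * Real.pi) * ((n - 1).factorial : ℝ) *
          Real.exp (CommPerm.S 2 n (k n) + (k n : ℝ) * CommPerm.E₂ ((k n : ℝ) / (n : ℝ)))) := by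
  refine ⟨⟨CommPerm.I1log_eq, CommPerm.I1_eq⟩, ?_⟩
  intro s hs _ k hk1 hequiv
  have hsqrt : Tendsto (fun n : ℕ => √(n : ℝ)) atTop atTop :=
    Real.tendsto_sqrt_atTop.comp tendsto_natCast_atTop_atTop
  have hq : Tendsto (fun n : ℕ => (k n : ℝ) / √(n : ℝ)) atTop (𝓝 s) := by
    have h1 := (isEquivalent_iff_tendsto_one (by
      filter_upwards [eventually_gt_atTop 0] with n hn
      have : (0 : ℝ) < n := by exact_mod_cast hn
      positivity)).1 hequiv
    have h2 := h1.const_mul s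
    rw [mul_one] at h2
    refine h2.congr fun n => ?_
    rw [Pi.div_apply, ← Real.sqrt_eq_rpow]
    field_simp
  have hk : Tendsto (fun n => (k n : ℝ)) atTop atTop := by
    refine (hq.pos_mul_atTop hs hsqrt).congr' ?_
    filter_upwards [eventually_gt_atTop 0] with n hn
    have : √(n : ℝ) ≠ 0 := (Real.sqrt_pos.2 (by exact_mod_cast hn)).ne'
    field_simp
  have hr : Tendsto (fun n => (k n / n : ℝ)) atTop (𝓝[>] 0) := by
    rw [tendsto_nhdsWithin_iff]
    constructor
    · refine (hq.div_atTop hsqrt).congr fun n => ?_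
      rw [div_div, Real.mul_self_sqrt (Nat.cast_nonneg n)]
    · filter_upwards [eventually_ge_atTop 1] with n hn
      have h1 : (0 : ℝ) < n := by exact_mod_cast hn
      have h2 : (0 : ℝ) < k n := by exact_mod_cast (hk1 n hn).1
      exact div_pos h2 h1
  -- The limit of k · (k/n) = (k/√n)² is s².
  refine CommPerm.A_two_isEquivalent (fun n hn => (hk1 n hn).1) hk hr (pow_pos hs 2) ?_
  refine (hq.pow 2).congr fun n => ?_
  rw [div_pow, Real.sq_sqrt (Nat.cast_nonneg n)]
  ring
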